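/- All graphs are finite and simple. The order and the size of a graph are its numbers of vertices and of edges. An odd-cycle graph is a graph with no even cycle. For a graph $G$ of order $n$ let $m_k(G)$ be the number of sets of $k$ pairwise disjoint edges of $G$, let $$m(G,x)=\sum_{k\ge 0}(-1)^k m_k(G)\,x^{n-2k}$$ be its matching polynomial, and let $t(G)$ be the largest real root of $m(G,x)$. Theorem 1.4. Let $G$ be an odd-cycle graph of order $n$ and size $m$, where $1\le m\le\lfloor 3(n-1)/2\rfloor$. Then $m(G,x)$ has a largest real root $t(G)$. For every integer $k\ge 1$ with $k-1\le m\le\lfloor 3(k-1)/2\rfloor$ there is an odd-cycle graph $F(k,m)$ of order $k$ and size $m$ that has a vertex of degree $k-1$, and it is unique up to isomorphism. Moreover: 1. If $m=1$, then $t(G)=1$. 2. If $m=2$, then $t(G)\le\sqrt2$, with equality if and only if $G$ is the disjoint union of a star $K_{1,2}$ and $n-3$ isolated vertices. 3. If $m=3$, then $t(G)\le\sqrt3$, with equality if and only if $G$ is the disjoint union of a triangle and $n-3$ isolated vertices, or (for $n\ge 4$) the disjoint union of a star $K_{1,3}$ and $n-4$ isolated vertices. 4. If $4\le m\le n-2$,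 then $t(G)\le t(F(m+1,m))$, with equality if and only if $G$ is the disjoint union of $F(m+1,m)$ and $n-m-1$ isolated vertices. 5. If $n-1\le m\le\lfloor 3(n-1)/2\rfloor$ and $m\ge 4$, then $t(G)\le t(F(n,m))$, with equality if and only if $G\cong F(n,m)$. -/

import Mathlib

open Polynomial
open scoped SimpleGraph

namespace OddCycle

/-- An odd-cycle graph: a simple graph with no even cycle. -/
def IsOddCycleGraph {V : Type*} (G : SimpleGraph V) : Prop :=
  ∀ (v : V) (p : G.Walk v v), p.IsCycle → ¬ Even p.length

/-- The size of a graph: its number of edges. -/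
noncomputable def size {V : Type*} (G : SimpleGraph V) : ℕ :=
  G.edgeSet.ncard

/-- `M` is a set of independent edges of `G`: no two distinct edges in it share a vertex. -/
def IsIndependentEdgeSet {V : Type*} (G : SimpleGraph V) (M : Finset (Sym2 V)) : Prop :=
  (∀ e ∈ M, e ∈ G.edgeSet) ∧ ∀ e ∈ M, ∀ f ∈ M, e ≠ f → ∀ v, v ∈ e → v ∉ f

/-- `m_k(G)`: the number of sets of `k` independent edges of `G`. -/
noncomputable def matchingCount {V : Type*} (G : SimpleGraph V) (k : ℕ) : ℕ :=
  {M : Finset (Sym2 V) | IsIndependentEdgeSet G M ∧ M.card = k}.ncard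

/-- The matching polynomial `∑ₖ (-1)ᵏ mₖ(G) xⁿ⁻²ᵏ`, where `n` is the order of `G`
(only `k ≤ n / 2` can contribute, as `k` independent edges cover `2 k` vertices). -/
noncomputable def matchingPoly {V : Type*} (G : SimpleGraph V) : ℝ[X] :=
  ∑ k ∈ Finset.range (Nat.card V / 2 + 1),
    C ((-1 : ℝ) ^ k * (matchingCount G k : ℝ)) * X ^ (Nat.card V - 2 * k)

/-- `t(G)`: the maximum matching root, i.e. the largest real root of the matching polynomial. -/
noncomputable def maxMatchingRoot {V : Type*} (G : SimpleGraph V) : ℝ :=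
  sSup {x : ℝ | (matchingPoly G).IsRoot x}

/-- `G` is (a copy of) `F(n, m)`: an odd-cycle graph of order `n` and size `m` that has a
vertex of degree `n - 1`, i.e. a vertex adjacent to all the others. -/
structure IsF {W : Type*} (n m : ℕ) (G : SimpleGraph W) : Prop where
  order_eq : Nat.card W = n
  size_eq : size G = m
  oddCycle : IsOddCycleGraph G
  exists_degree : ∃ v : W, (G.neighborSet v).ncard = n - 1

end OddCycle

/-! Put z = 1/y and let M(S) be the sum of (-z)^|N| over the matchings N inside S (`matchingSum`).
For x ≠ 0 and y = x², m(G,x) = xⁿ M(V), so t(G)² is the largest positive y at which M(V) vanishes.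

The extremal graphs are windmills: triangles and pendant edges at a centre c, plus isolated
vertices. Put d = 2/(y-1). In the recurrence at c a pendant edge contributes 1 and a triangle 2 + d,
so a windmill with m edges and centre degree g has M(V) = 0 when y = g + d(m-g). An arbitrary vertex
set S gets the weight w = |S| + d(e(S)-|S|+1); for a windmill without isolated vertices the
condition reads w = y + 1.

The core is `IsOddCycleGraph.rootBound`: if S is connected, w ≤ y + 1 and v ∈ S, then M(S-v) > 0 and
(y-w+1) M(S-v) ≤ y M(S). It is proved by induction on |S|, splitting off one component B of S-v. As
there are no even cycles, v has at most two neighbours in B, and two such neighbours are the ends of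
a bridge of B or of a longer connection that begins and ends with a bridge
(`IsOddCycleGraph.exists_branch`). The defect of the inequality splits accordingly
(`Hang.defect_eq`), and one real inequality for each kind of branch closes the induction
(`branch_bound`).

Hence M > 0 on connected sets of weight below y + 1, and M(V) ≠ 0 because M is multiplicative over
components. If connected sets have at most N vertices and d ≤ 1, the weight is largest at N vertices
and m edges, which fixes the critical y. A zero there lives on a connected set of weight y + 1; the
equality analysis gives it a dominating vertex (`IsOddCycleGraph.exists_dominating`), so G is a
windmill, and windmills are determined by order, size and centre degree. For m = 3 the critical
values are y = 3 and d = 1, the weight is e(S) + 1 whatever the order, and two extremal graphs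
appear. -/

namespace OddCycle

/-! ### Signed matching sums: deletion recurrence and gluing. -/

section MatchingSum

open scoped Classical

variable {V : Type*} {G : SimpleGraph V}

/-- Twice the number of edges of `G` inside `S`. -/
noncomputable def degSum (G : SimpleGraph V) (S : Finset V) : ℕ :=
  ∑ a ∈ S, (S.filter (G.Adj a)).card

theorem degSum_mono {S S' : Finset V} (h : S ⊆ S') : degSum G S ≤ degSum G S' :=
  (Finset.sum_le_sum fun _ _ => Finset.card_le_card (Finset.filter_subset_filter _ h)).trans
    (Finset.sum_le_sum_of_subset h)

theorem degSum_singleton (v : V) : degSum G {v} = 0 := by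
  simp [degSum, Finset.filter_singleton]

theorem degSum_glue {A B : Finset V} {v : V} (hv : v ∈ A) (hd : Disjoint A B)
    (h : ∀ a ∈ A, ∀ b ∈ B, G.Adj a b → a = v) :
    degSum G (A ∪ B) = degSum G A + degSum G B + 2 * (B.filter (G.Adj v)).card := by
  have hsplit : ∀ a, ((A ∪ B).filter (G.Adj a)).card =
      (A.filter (G.Adj a)).card + (B.filter (G.Adj a)).card := fun a => by
    rw [Finset.filter_union, Finset.card_union_of_disjoint (Finset.disjoint_filter_filter hd)]
  unfold degSum
  rw [Finset.sum_union hd]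
  simp only [hsplit, Finset.sum_add_distrib]
  have h1 : ∑ a ∈ A, (B.filter (G.Adj a)).card = (B.filter (G.Adj v)).card := by
    refine Finset.sum_eq_single_of_mem v hv fun a ha hav => ?_
    rw [Finset.card_eq_zero, Finset.filter_eq_empty_iff]
    exact fun b hb hab => hav (h a ha b hb hab)
  have h2 : ∑ b ∈ B, (A.filter (G.Adj b)).card = (B.filter (G.Adj v)).card := by
    rw [Finset.card_filter]
    refine Finset.sum_congr rfl fun b hb => ?_
    split_ifs with hvb
    · rw [Finset.card_eq_one]
      refine ⟨v, ?_⟩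
      ext a
      simp only [Finset.mem_filter, Finset.mem_singleton]
      exact ⟨fun ha => h a ha.1 b hb ha.2.symm, by rintro rfl; exact ⟨hv, hvb.symm⟩⟩
    · rw [Finset.card_eq_zero, Finset.filter_eq_empty_iff]
      intro a ha hab
      exact hvb (h a ha b hb hab.symm ▸ hab.symm)
  omega

variable [Fintype V]

/-- The matchings of `G` all of whose edges lie inside `S`. -/
noncomputable def matchingsIn (G : SimpleGraph V) (S : Finset V) : Finset (Finset (Sym2 V)) :=
  Finset.univ.filter fun N => IsIndependentEdgeSet G N ∧ ∀ e ∈ N, ∀ v ∈ e, v ∈ S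

/-- The signed matching generating function `∑ (-z) ^ |N|` of the subgraph induced on `S`. -/
noncomputable def matchingSum (G : SimpleGraph V) (z : ℝ) (S : Finset V) : ℝ :=
  ∑ N ∈ matchingsIn G S, (-z) ^ N.card

theorem mem_matchingsIn {S : Finset V} {N : Finset (Sym2 V)} :
    N ∈ matchingsIn G S ↔ IsIndependentEdgeSet G N ∧ ∀ e ∈ N, ∀ v ∈ e, v ∈ S := by
  simp [matchingsIn]

theorem insert_mem_matchingsIn {S : Finset V} {v u : V} (hv : v ∈ S) (hu : u ∈ S)
    (h : G.Adj v u) {N : Finset (Sym2 V)} (hN : N ∈ matchingsIn G ((S.erase v).erase u)) :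
    insert s(v, u) N ∈ matchingsIn G S := by
  rw [mem_matchingsIn] at hN ⊢
  obtain ⟨⟨h1, h2⟩, h3⟩ := hN
  have h4 : ∀ e ∈ N, v ∉ e ∧ u ∉ e := by
    intro e he
    constructor <;> intro hh <;> simpa using h3 e he _ hh
  refine ⟨⟨?_, ?_⟩, ?_⟩
  · intro e he
    rcases Finset.mem_insert.1 he with rfl | he
    · exact h
    · exact h1 e he
  · intro e he f hf hef w hw hw'
    rcases Finset.mem_insert.1 he with rfl | he1 <;>
      rcases Finset.mem_insert.1 hf with rfl | hf1
    · exact hef rfl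
    · rcases Sym2.mem_iff.1 hw with rfl | rfl
      · exact (h4 f hf1).1 hw'
      · exact (h4 f hf1).2 hw'
    · rcases Sym2.mem_iff.1 hw' with rfl | rfl
      · exact (h4 e he1).1 hw
      · exact (h4 e he1).2 hw
    · exact h2 e he1 f hf1 hef w hw hw'
  · intro e he w hw
    rcases Finset.mem_insert.1 he with rfl | he
    · rcases Sym2.mem_iff.1 hw with rfl | rfl <;> assumption
    · exact Finset.mem_of_mem_erase (Finset.mem_of_mem_erase (h3 e he w hw))

theorem notMem_of_mem_matchingsIn_erase {S : Finset V} {v u : V} {N : Finset (Sym2 V)}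
    (hN : N ∈ matchingsIn G ((S.erase v).erase u)) : s(v, u) ∉ N := by
  intro h
  simpa using (mem_matchingsIn.1 hN).2 _ h u (by simp)

/-- A matching either misses `v` or contains exactly one edge at `v`; this is the combinatorial
content of `matchingSum_rec`. -/
theorem matchingsIn_eq {S : Finset V} {v : V} (hv : v ∈ S) :
    matchingsIn G S = matchingsIn G (S.erase v) ∪ (S.filter (G.Adj v)).biUnion
      fun u => (matchingsIn G ((S.erase v).erase u)).image (insert s(v, u)) := by
  ext N
  simp only [Finset.mem_union, Finset.mem_biUnion, Finset.mem_filter, Finset.mem_image]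
  constructor
  · intro hN
    have hN' := mem_matchingsIn.1 hN
    by_cases hc : ∃ e ∈ N, v ∈ e
    · right
      obtain ⟨e, he, hve⟩ := hc
      obtain ⟨u, rfl⟩ := hve
      have hadj : G.Adj v u := hN'.1.1 _ he
      refine ⟨u, ⟨hN'.2 _ he u (by simp), hadj⟩, N.erase s(v, u), ?_, Finset.insert_erase he⟩
      rw [mem_matchingsIn]
      refine ⟨⟨fun e h => hN'.1.1 e (Finset.mem_of_mem_erase h), fun e h f h' =>
        hN'.1.2 e (Finset.mem_of_mem_erase h) f (Finset.mem_of_mem_erase h')⟩, ?_⟩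
      intro f hf w hw
      have hf' := Finset.mem_erase.1 hf
      simp only [Finset.mem_erase]
      refine ⟨?_, ?_, hN'.2 _ hf'.2 w hw⟩
      · rintro rfl
        exact hN'.1.2 f hf'.2 _ he hf'.1 w hw (by simp)
      · rintro rfl
        exact hN'.1.2 f hf'.2 _ he hf'.1 w hw (by simp)
    · left
      push Not at hc
      rw [mem_matchingsIn]
      refine ⟨hN'.1, fun e he w hw => Finset.mem_erase.2 ⟨?_, hN'.2 e he w hw⟩⟩
      rintro rfl
      exact hc e he hw
  · rintro (hN | ⟨u, ⟨hu, hadj⟩, N', hN', rfl⟩)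
    · rw [mem_matchingsIn] at hN ⊢
      exact ⟨hN.1, fun e he w hw => Finset.mem_of_mem_erase (hN.2 e he w hw)⟩
    · exact insert_mem_matchingsIn hv hu hadj hN'

theorem matchingSum_rec (z : ℝ) {S : Finset V} {v : V} (hv : v ∈ S) :
    matchingSum G z S = matchingSum G z (S.erase v) -
      z * ∑ u ∈ S.filter (G.Adj v), matchingSum G z ((S.erase v).erase u) := by
  unfold matchingSum
  rw [matchingsIn_eq hv, Finset.sum_union, Finset.sum_biUnion, sub_eq_add_neg, Finset.mul_sum,
    ← Finset.sum_neg_distrib]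
  · congr 1
    refine Finset.sum_congr rfl fun u _ => ?_
    rw [Finset.sum_image, Finset.mul_sum, ← Finset.sum_neg_distrib]
    · refine Finset.sum_congr rfl fun N hN => ?_
      rw [Finset.card_insert_of_notMem (notMem_of_mem_matchingsIn_erase hN)]
      ring
    · intro N hN N' hN' h
      have := congrArg (fun M => M.erase s(v, u)) h
      simpa [Finset.erase_insert (notMem_of_mem_matchingsIn_erase hN),
        Finset.erase_insert (notMem_of_mem_matchingsIn_erase hN')] using this
  · intro u hu w hw huw
    rw [Function.onFun, Finset.disjoint_left]
    simp only [Finset.mem_image, not_exists, not_and]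
    rintro _ ⟨N, hN, rfl⟩ N' hN' h
    have h1 : s(v, u) ∈ insert s(v, w) N' := h ▸ Finset.mem_insert_self _ _
    rcases Finset.mem_insert.1 h1 with h1 | h1
    · exact huw (Sym2.congr_right.1 h1)
    · simpa using (mem_matchingsIn.1 hN').2 _ h1 v (by simp)
  · rw [Finset.disjoint_left]
    simp only [Finset.mem_biUnion, Finset.mem_image, not_exists, not_and]
    rintro N hN u _ N' hN' rfl
    simpa using (mem_matchingsIn.1 hN).2 _ (Finset.mem_insert_self _ _) v (by simp)

theorem matchingSum_empty (z : ℝ) : matchingSum G z ∅ = 1 := by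
  have : matchingsIn G ∅ = {∅} := by
    ext N
    rw [mem_matchingsIn, Finset.mem_singleton]
    constructor
    · rintro ⟨_, h⟩
      refine Finset.eq_empty_of_forall_notMem fun e he => ?_
      induction e with
      | _ a b => simpa using h _ he a (by simp)
    · rintro rfl
      exact ⟨⟨by simp, by simp⟩, by simp⟩
  simp [matchingSum, this]

theorem matchingSum_eq_erase (z : ℝ) {S : Finset V} {v : V} (h : ∀ u ∈ S, ¬ G.Adj v u) :
    matchingSum G z S = matchingSum G z (S.erase v) := by
  by_cases hv : v ∈ S
  · rw [matchingSum_rec z hv, Finset.filter_false_of_mem h]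
    simp
  · rw [Finset.erase_eq_of_notMem hv]

theorem matchingSum_singleton (z : ℝ) (v : V) : matchingSum G z {v} = 1 := by
  rw [matchingSum_eq_erase z (v := v) (by simp)]
  simp [matchingSum_empty]

/-- Induction on `A`: the recurrence at a vertex of `A` only meets neighbours in `A`, so the factor
of `B` comes out of every term. -/
theorem matchingSum_union (z : ℝ) {A B : Finset V} (hd : Disjoint A B)
    (h : ∀ a ∈ A, ∀ b ∈ B, ¬ G.Adj a b) :
    matchingSum G z (A ∪ B) = matchingSum G z A * matchingSum G z B := by
  induction A using Finset.strongInduction with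
  | H A ih =>
    rcases A.eq_empty_or_nonempty with rfl | ⟨v, hv⟩
    · simp [matchingSum_empty]
    · have hvB : v ∉ B := Finset.disjoint_left.1 hd hv
      have key : ∀ C ⊆ A.erase v, matchingSum G z (C ∪ B) =
          matchingSum G z C * matchingSum G z B := fun C hC =>
        ih C (hC.trans_ssubset (Finset.erase_ssubset hv))
          (Finset.disjoint_of_subset_left (hC.trans (Finset.erase_subset _ _)) hd)
          fun a ha => h a (Finset.mem_of_mem_erase (hC ha))
      rw [matchingSum_rec z (Finset.mem_union_left B hv), matchingSum_rec z hv,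
        Finset.erase_union_distrib, Finset.erase_eq_of_notMem hvB, key _ subset_rfl,
        Finset.filter_union, Finset.filter_false_of_mem (s := B) (h v hv), Finset.union_empty,
        sub_mul, mul_assoc, Finset.sum_mul]
      congr 2
      refine Finset.sum_congr rfl fun u hu => ?_
      have huB : u ∉ B := Finset.disjoint_left.1 hd (Finset.mem_filter.1 hu).1
      rw [Finset.erase_union_distrib, Finset.erase_eq_of_notMem huB,
        key _ (Finset.erase_subset _ _)]

/-- Gluing formula for two vertex sets all of whose mutual edges start at one vertex `v`. -/
theorem matchingSum_glue (z : ℝ) {A B : Finset V} {v : V} (hv : v ∈ A) (hd : Disjoint A B)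
    (h : ∀ a ∈ A, ∀ b ∈ B, G.Adj a b → a = v) :
    matchingSum G z (A ∪ B) = matchingSum G z A * matchingSum G z B -
      z * matchingSum G z (A.erase v) *
        ∑ u ∈ B.filter (G.Adj v), matchingSum G z (B.erase u) := by
  have hvB : v ∉ B := Finset.disjoint_left.1 hd hv
  have key : ∀ C ⊆ A.erase v, ∀ D ⊆ B, matchingSum G z (C ∪ D) =
      matchingSum G z C * matchingSum G z D := by
    intro C hC D hD
    refine matchingSum_union z (Finset.disjoint_of_subset_left
      (hC.trans (Finset.erase_subset _ _)) (Finset.disjoint_of_subset_right hD hd)) ?_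
    intro a ha b hb hab
    have := Finset.mem_erase.1 (hC ha)
    exact this.1 (h a this.2 b (hD hb) hab)
  rw [matchingSum_rec z (Finset.mem_union_left B hv), Finset.erase_union_distrib,
    Finset.erase_eq_of_notMem hvB, key _ subset_rfl _ subset_rfl, Finset.filter_union,
    Finset.sum_union (Finset.disjoint_filter_filter hd)]
  have h1 : ∑ u ∈ A.filter (G.Adj v), matchingSum G z ((A.erase v ∪ B).erase u) =
      (∑ u ∈ A.filter (G.Adj v), matchingSum G z ((A.erase v).erase u)) * matchingSum G z B := by
    rw [Finset.sum_mul]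
    refine Finset.sum_congr rfl fun u hu => ?_
    have huB : u ∉ B := Finset.disjoint_left.1 hd (Finset.mem_filter.1 hu).1
    rw [Finset.erase_union_distrib, Finset.erase_eq_of_notMem huB,
      key _ (Finset.erase_subset _ _) _ subset_rfl]
  have h2 : ∑ u ∈ B.filter (G.Adj v), matchingSum G z ((A.erase v ∪ B).erase u) =
      matchingSum G z (A.erase v) * ∑ u ∈ B.filter (G.Adj v), matchingSum G z (B.erase u) := by
    rw [Finset.mul_sum]
    refine Finset.sum_congr rfl fun u hu => ?_
    have huA : u ∉ A.erase v := fun h' =>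
      Finset.disjoint_left.1 hd (Finset.mem_of_mem_erase h') (Finset.mem_filter.1 hu).1
    rw [Finset.erase_union_distrib, Finset.erase_eq_of_notMem huA,
      key _ subset_rfl _ (Finset.erase_subset _ _)]
  rw [h1, h2, matchingSum_rec z hv]
  ring

theorem matchingSum_glue_erase (z : ℝ) {A B : Finset V} {v : V} (hv : v ∈ A) (hd : Disjoint A B)
    (h : ∀ a ∈ A, ∀ b ∈ B, G.Adj a b → a = v) :
    matchingSum G z ((A ∪ B).erase v) = matchingSum G z (A.erase v) * matchingSum G z B := by
  rw [Finset.erase_union_distrib, Finset.erase_eq_of_notMem (Finset.disjoint_left.1 hd hv)]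
  refine matchingSum_union z (Finset.disjoint_of_subset_left (Finset.erase_subset _ _) hd) ?_
  intro a ha b hb hab
  have := Finset.mem_erase.1 ha
  exact this.1 (h a this.2 b hb hab)

theorem degSum_univ : degSum G Finset.univ = 2 * size G := by
  have := G.sum_degrees_eq_twice_card_edges
  rw [size, ← SimpleGraph.coe_edgeFinset, Set.ncard_coe_finset, ← this]
  refine Finset.sum_congr rfl fun v _ => ?_
  rw [← SimpleGraph.card_neighborFinset_eq_degree]
  congr 1
  ext
  simp

end MatchingSum

/-! ### Connected vertex sets and the structure of odd-cycle graphs. -/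

section Structure

open scoped Classical

variable {V : Type*} {G : SimpleGraph V}

/-- The subgraph of `G` induced on `S` is connected. -/
def ConnOn (G : SimpleGraph V) (S : Finset V) : Prop :=
  S.Nonempty ∧ ∀ a ∈ S, ∀ b ∈ S, ∃ p : G.Walk a b, ∀ z ∈ p.support, z ∈ S

theorem ConnOn.of_base {S : Finset V} {v : V} (hv : v ∈ S)
    (h : ∀ a ∈ S, ∃ p : G.Walk a v, ∀ z ∈ p.support, z ∈ S) : ConnOn G S := by
  refine ⟨⟨v, hv⟩, fun a ha b hb => ?_⟩
  obtain ⟨p, hp⟩ := h a ha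
  obtain ⟨q, hq⟩ := h b hb
  refine ⟨p.append q.reverse, fun z hz => ?_⟩
  rcases (SimpleGraph.Walk.mem_support_append_iff _ _).1 hz with hz | hz
  · exact hp z hz
  · exact hq z (by simpa using hz)

theorem connOn_singleton (v : V) : ConnOn G {v} :=
  ConnOn.of_base (Finset.mem_singleton_self v) fun a ha => by
    obtain rfl := Finset.mem_singleton.1 ha
    exact ⟨SimpleGraph.Walk.nil, by simp⟩

theorem ConnOn.union {A B : Finset V} (hA : ConnOn G A) (hB : ConnOn G B) {a b : V}
    (ha : a ∈ A) (hb : b ∈ B) (hab : G.Adj a b) : ConnOn G (A ∪ B) := by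
  refine ConnOn.of_base (Finset.mem_union_left B ha) fun c hc => ?_
  rcases Finset.mem_union.1 hc with hc | hc
  · obtain ⟨p, hp⟩ := hA.2 c hc a ha
    exact ⟨p, fun z hz => Finset.mem_union_left _ (hp z hz)⟩
  · obtain ⟨p, hp⟩ := hB.2 c hc b hb
    refine ⟨p.concat hab.symm, fun z hz => ?_⟩
    rw [SimpleGraph.Walk.support_concat, List.mem_append,
      List.mem_singleton] at hz
    rcases hz with hz | rfl
    · exact Finset.mem_union_right _ (hp z hz)
    · exact Finset.mem_union_left _ ha

/-- Removing a vertex `v` from a connected set splits off the component of a given `w`. -/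
theorem ConnOn.exists_component {S : Finset V} (hS : ConnOn G S) {v w : V} (hv : v ∈ S)
    (hw : w ∈ S) (hwv : w ≠ v) :
    ∃ D ⊆ S, v ∉ D ∧ w ∈ D ∧ ConnOn G D ∧ ConnOn G (S \ D) ∧
      (∀ a ∈ S \ D, ∀ b ∈ D, G.Adj a b → a = v) ∧ (D.filter (G.Adj v)).Nonempty := by
  -- `D` is the component of `w` in `S - v`; `hcross` then says that edges leave it only towards
  -- `v`.
  set D : Finset V := S.filter fun z => ∃ p : G.Walk w z, ∀ t ∈ p.support, t ∈ S.erase v with hD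
  have hDS : D ⊆ S := Finset.filter_subset _ _
  have hvD : v ∉ D := by
    intro h
    obtain ⟨p, hp⟩ := (Finset.mem_filter.1 h).2
    simpa using hp v p.end_mem_support
  have hwD : w ∈ D := by
    refine Finset.mem_filter.2 ⟨hw, SimpleGraph.Walk.nil, ?_⟩
    simpa using ⟨hwv, hw⟩
  have hcross : ∀ a ∈ S \ D, ∀ b ∈ D, G.Adj a b → a = v := by
    intro a ha b hb hab
    by_contra hav
    obtain ⟨haS, haD⟩ := Finset.mem_sdiff.1 ha
    obtain ⟨p, hp⟩ := (Finset.mem_filter.1 hb).2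
    refine haD (Finset.mem_filter.2 ⟨haS, p.concat hab.symm, fun t ht => ?_⟩)
    rw [SimpleGraph.Walk.support_concat, List.mem_append,
      List.mem_singleton] at ht
    rcases ht with ht | rfl
    · exact hp t ht
    · exact Finset.mem_erase.2 ⟨hav, haS⟩
  refine ⟨D, hDS, hvD, hwD, ?_, ?_, hcross, ?_⟩
  · refine ConnOn.of_base hwD fun a ha => ?_
    obtain ⟨p, hp⟩ := (Finset.mem_filter.1 ha).2
    refine ⟨p.reverse, fun z hz => ?_⟩
    have hz' : z ∈ p.support := by simpa using hz
    exact Finset.mem_filter.2 ⟨Finset.mem_of_mem_erase (hp z hz'), p.takeUntil z hz',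
      fun t ht => hp t (p.support_takeUntil_subset_support hz' ht)⟩
  · have hvSD : v ∈ S \ D := Finset.mem_sdiff.2 ⟨hv, hvD⟩
    -- A walk towards `v` that starts outside `D` can enter `D` only from `v`, so it may be cut
    -- there.
    have key : ∀ (a b : V) (p : G.Walk a b), b = v → (∀ z ∈ p.support, z ∈ S) → a ∉ D →
        ∃ q : G.Walk a v, ∀ z ∈ q.support, z ∈ S \ D := by
      intro a b p
      induction p with
      | nil =>
        rintro rfl _ _
        exact ⟨SimpleGraph.Walk.nil, by simpa using hvSD⟩
      | @cons a c b h p ih =>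
        intro hb hp ha
        have haS : a ∈ S \ D := Finset.mem_sdiff.2 ⟨hp a (by simp), ha⟩
        by_cases hc : c ∈ D
        · obtain rfl := hcross a haS c hc h
          exact ⟨SimpleGraph.Walk.nil, by simpa using hvSD⟩
        · obtain ⟨q, hq⟩ := ih hb (fun z hz => hp z (by simp [hz])) hc
          refine ⟨q.cons h, fun z hz => ?_⟩
          rcases List.mem_cons.1 (SimpleGraph.Walk.support_cons h q ▸ hz) with rfl | hz
          · exact haS
          · exact hq z hz
    refine ConnOn.of_base hvSD fun a ha => ?_
    obtain ⟨haS, haD⟩ := Finset.mem_sdiff.1 ha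
    obtain ⟨p, hp⟩ := hS.2 a haS v hv
    exact key a v p rfl hp haD
  · have key : ∀ (a b : V) (p : G.Walk a b), b = v → (∀ z ∈ p.support, z ∈ S) → a ∈ D →
        (D.filter (G.Adj v)).Nonempty := by
      intro a b p
      induction p with
      | nil =>
        rintro rfl _ h
        exact absurd h hvD
      | @cons a c b h p ih =>
        intro hb hp ha
        by_cases hc : c ∈ D
        · exact ih hb (fun z hz => hp z (by simp [hz])) hc
        · obtain rfl := hcross c (Finset.mem_sdiff.2 ⟨hp c (by simp), hc⟩) a ha h.symm
          exact ⟨a, Finset.mem_filter.2 ⟨ha, h.symm⟩⟩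
    obtain ⟨p, hp⟩ := hS.2 w hw v hv
    exact key w v p rfl hp hwD

/-- In an odd-cycle graph, a path joining two neighbours of a vertex off the path is odd. -/
theorem IsOddCycleGraph.odd_length (hG : IsOddCycleGraph G) {v u w : V} (hu : G.Adj v u)
    (hw : G.Adj v w) (huw : u ≠ w) {p : G.Walk u w} (hp : p.IsPath) (hv : v ∉ p.support) :
    Odd p.length := by
  -- Closing the path through `v` adds two edges, so the parity of the cycle is that of the path.
  have hc : ((p.concat hw.symm).cons hu).IsCycle := by
    rw [SimpleGraph.Walk.cons_isCycle_iff]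
    refine ⟨hp.concat hv hw.symm, fun h => ?_⟩
    rw [SimpleGraph.Walk.edges_concat, List.concat_eq_append, List.mem_append,
      List.mem_singleton] at h
    rcases h with h | h
    · exact hv (p.fst_mem_support_of_mem_edges h)
    · rw [Sym2.eq_swap] at h
      exact huw (Sym2.congr_left.1 h)
  have := hG v _ hc
  simp only [SimpleGraph.Walk.length_cons, SimpleGraph.Walk.length_concat,
    Nat.not_even_iff_odd] at this
  rw [Nat.odd_iff] at this ⊢
  omega

theorem IsOddCycleGraph.no_four_cycle (hG : IsOddCycleGraph G) {v u w x : V} (hu : G.Adj v u)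
    (hw : G.Adj v w) (hux : G.Adj u x) (hxw : G.Adj x w) (huw : u ≠ w) (hvx : v ≠ x) : False := by
  have hp : (SimpleGraph.Walk.cons hux (SimpleGraph.Walk.cons hxw SimpleGraph.Walk.nil)).IsPath := by
    simp [SimpleGraph.Walk.cons_isPath_iff, hux.ne, hxw.ne, huw]
  have := hG.odd_length hu hw huw hp (by simp [hu.ne, hw.ne, hvx])
  exact absurd this (by simp [Nat.odd_iff])

theorem isPath_append_of_inter {a b c : V} {p : G.Walk a b} {q : G.Walk b c} (hp : p.IsPath)
    (hq : q.IsPath) (h : ∀ t ∈ p.support, t ∈ q.support → t = b) : (p.append q).IsPath := by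
  rw [SimpleGraph.Walk.isPath_def, SimpleGraph.Walk.support_append, List.nodup_append']
  have hq' := hq.support_nodup
  refine ⟨hp.support_nodup, hq'.tail, ?_⟩
  intro t ht ht'
  have htq : t ∈ q.support := List.mem_of_mem_tail ht'
  obtain rfl := h t ht htq
  rw [← SimpleGraph.Walk.cons_tail_support, List.nodup_cons] at hq'
  exact hq'.1 ht'

/-- In an odd-cycle graph, a vertex has at most two neighbours in a connected set avoiding it. -/
theorem IsOddCycleGraph.card_neighbors_le_two (hG : IsOddCycleGraph G) {S : Finset V}
    (hS : ConnOn G S) {v : V} (hv : v ∉ S) : (S.filter (G.Adj v)).card ≤ 2 := by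
  by_contra hcard
  obtain ⟨a, b, c, ha, hb, hc, hab, hac, hbc⟩ := Finset.two_lt_card_iff.1 (not_le.1 hcard)
  obtain ⟨haS, hva⟩ := Finset.mem_filter.1 ha
  obtain ⟨hbS, hvb⟩ := Finset.mem_filter.1 hb
  obtain ⟨hcS, hvc⟩ := Finset.mem_filter.1 hc
  obtain ⟨p, hpp, hp⟩ : ∃ p : G.Walk a b, p.IsPath ∧ ∀ z ∈ p.support, z ∈ S := by
    obtain ⟨p, hp⟩ := hS.2 a haS b hbS
    exact ⟨p.bypass, p.bypass_isPath, fun z hz => hp z (p.support_bypass_subset_support hz)⟩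
  obtain ⟨q, hqp, hq⟩ : ∃ q : G.Walk c a, q.IsPath ∧ ∀ z ∈ q.support, z ∈ S := by
    obtain ⟨p, hp⟩ := hS.2 c hcS a haS
    exact ⟨p.bypass, p.bypass_isPath, fun z hz => hp z (p.support_bypass_subset_support hz)⟩
  -- `x` is the first vertex of `q` on `p`. The legs from `x` to `a`, `b`, `c` form paths two by
  -- two, so their lengths would have three odd pairwise sums; but these sums add up to an even
  -- number.
  obtain ⟨x, hxp, hxq, hx⟩ := q.exists_mem_support_forall_mem_support_imp_eq p.support.toFinset
    ⟨a, by simp⟩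
  rw [List.mem_toFinset] at hxp
  have h1 : ((q.takeUntil x hxq).append (p.takeUntil x hxp).reverse).IsPath := by
    refine isPath_append_of_inter (hqp.takeUntil hxq) (hpp.takeUntil hxp).reverse ?_
    intro t ht ht'
    refine hx t ?_ ht
    rw [SimpleGraph.Walk.support_reverse, List.mem_reverse] at ht'
    exact List.mem_toFinset.2 (p.support_takeUntil_subset_support hxp ht')
  have h2 : ((q.takeUntil x hxq).append (p.dropUntil x hxp)).IsPath := by
    refine isPath_append_of_inter (hqp.takeUntil hxq) (hpp.dropUntil hxp) ?_
    intro t ht ht'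
    exact hx t (List.mem_toFinset.2 (p.support_dropUntil_subset_support hxp ht')) ht
  have o1 := hG.odd_length hvc hva hac.symm h1 fun h => by
    rcases (SimpleGraph.Walk.mem_support_append_iff _ _).1 h with h | h
    · exact hv (hq v (q.support_takeUntil_subset_support hxq h))
    · rw [SimpleGraph.Walk.support_reverse, List.mem_reverse] at h
      exact hv (hp v (p.support_takeUntil_subset_support hxp h))
  have o2 := hG.odd_length hvc hvb hbc.symm h2 fun h => by
    rcases (SimpleGraph.Walk.mem_support_append_iff _ _).1 h with h | h
    · exact hv (hq v (q.support_takeUntil_subset_support hxq h))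
    · exact hv (hp v (p.support_dropUntil_subset_support hxp h))
  have o3 := hG.odd_length hva hvb hab hpp fun h => hv (hp v h)
  have e := congrArg SimpleGraph.Walk.length (p.take_spec hxp)
  rw [SimpleGraph.Walk.length_append] at o1 o2 e
  rw [SimpleGraph.Walk.length_reverse] at o1
  rw [Nat.odd_iff] at o1 o2 o3
  omega

/-! ### Branches hanging at a vertex. -/

theorem filter_adj_eq_singleton {S : Finset V} {v u : V} (hu : u ∈ S.filter (G.Adj v))
    (h : (S.filter (G.Adj v)).card ≤ 1) : S.filter (G.Adj v) = {u} :=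
  Finset.eq_singleton_iff_unique_mem.2 ⟨hu, fun _ hw => Finset.card_le_one.1 h _ hw _ hu⟩

/-- `S = A ∪ B` with `A`, `B` disjoint and connected, all edges between `A` and `B` start at the
vertex `v` of `A`, and `N` is the set of neighbours of `v` in `B`. -/
structure Hang (G : SimpleGraph V) (S A B : Finset V) (v : V) (N : Finset V) : Prop where
  union_eq : A ∪ B = S
  mem : v ∈ A
  disj : Disjoint A B
  cross : ∀ a ∈ A, ∀ b ∈ B, G.Adj a b → a = v
  nbrs : B.filter (G.Adj v) = N
  connA : ConnOn G A
  connB : ConnOn G B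

theorem Hang.mem_nbrs {S A B N : Finset V} {v : V} (h : Hang G S A B v N) {u : V} :
    u ∈ N ↔ u ∈ B ∧ G.Adj v u := by
  rw [← h.nbrs, Finset.mem_filter]

/-- With a single neighbour the joining edge is a bridge, and either side may be seen as hanging
from the other. -/
theorem Hang.symm {S A B : Finset V} {v u : V} (h : Hang G S A B v {u}) :
    Hang G S B A u {v} := by
  have hu := h.mem_nbrs.1 (Finset.mem_singleton_self u)
  have hcross : ∀ b ∈ B, ∀ a ∈ A, G.Adj b a → b = u := fun b hb a ha hab => by
    obtain rfl := h.cross a ha b hb hab.symm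
    exact Finset.mem_singleton.1 (h.mem_nbrs.2 ⟨hb, hab.symm⟩)
  refine ⟨by rw [Finset.union_comm, h.union_eq], hu.1, h.disj.symm, hcross, ?_, h.connB, h.connA⟩
  ext a
  simp only [Finset.mem_filter, Finset.mem_singleton]
  exact ⟨fun ha => h.cross a ha.1 u hu.1 ha.2.symm, by rintro rfl; exact ⟨h.mem, hu.2.symm⟩⟩

theorem ConnOn.exists_hang {S : Finset V} (hS : ConnOn G S) {v w : V} (hv : v ∈ S)
    (hw : w ∈ S) (hwv : w ≠ v) :
    ∃ A B N, Hang G S A B v N ∧ w ∈ B ∧ N.Nonempty := by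
  obtain ⟨D, hDS, hvD, hwD, hD, hSD, hcross, hne⟩ := hS.exists_component hv hw hwv
  exact ⟨S \ D, D, _, ⟨Finset.sdiff_union_of_subset hDS, Finset.mem_sdiff.2 ⟨hv, hvD⟩,
    Finset.sdiff_disjoint, hcross, rfl, hSD, hD⟩, hwD, hne⟩

/-- If `u` and `w` in a connected set `B` both have a neighbour in a connected set `E` disjoint
from `B`, then the component of `w` in `B - u` hangs at `u` by a single edge. -/
theorem IsOddCycleGraph.exists_bridge (hG : IsOddCycleGraph G) {B E : Finset V}
    (hB : ConnOn G B) (hE : ConnOn G E) (hBE : Disjoint B E) {u w e e' : V} (hu : u ∈ B)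
    (hw : w ∈ B) (hwu : w ≠ u) (he : e ∈ E) (he' : e' ∈ E) (hue : G.Adj u e)
    (hwe : G.Adj w e') : ∃ P D p, Hang G B P D u {p} ∧ w ∈ D := by
  obtain ⟨P, D, N, hH, hwD, p, hp⟩ := hB.exists_hang hu hw hwu
  have hDB : D ⊆ B := hH.union_eq ▸ Finset.subset_union_right
  have hDE : Disjoint D E := Finset.disjoint_of_subset_left hDB hBE
  have huDE : u ∉ D ∪ E := by
    rw [Finset.mem_union, not_or]
    exact ⟨Finset.disjoint_left.1 hH.disj hH.mem, Finset.disjoint_left.1 hBE hu⟩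
  -- `D ∪ E` is connected through the edge `w e'` and avoids `u`. One of the at most two neighbours
  -- of `u` in it lies in `E`, which leaves one for `D`.
  have h2 := hG.card_neighbors_le_two (hH.connB.union hE hwD he' hwe) huDE
  rw [Finset.filter_union, Finset.card_union_of_disjoint (Finset.disjoint_filter_filter hDE)] at h2
  have h3 : 0 < (E.filter (G.Adj u)).card := Finset.card_pos.2 ⟨e, Finset.mem_filter.2 ⟨he, hue⟩⟩
  have hN : N = {p} := by
    rw [← hH.nbrs] at hp ⊢
    exact filter_adj_eq_singleton hp (by omega)
  exact ⟨P, D, p, hN ▸ hH, hwD⟩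

/-- The ways in which a branch `B` can hang at a vertex of an odd-cycle graph: by one edge, by the
two ends of an edge, or by the two ends of a longer chain of bridges. -/
inductive Branch (G : SimpleGraph V) (B : Finset V) : Finset V → Prop
  | single (u : V) : Branch G B {u}
  | edge (u w : V) (P R : Finset V) (h : Hang G B P R u {w}) : Branch G B {u, w}
  | chain (u w p q : V) (P Q R : Finset V) (huw : u ≠ w) (hP : Hang G B P (Q ∪ R) u {p})
      (hR : Hang G B R (P ∪ Q) w {q}) (hQ : Hang G (Q ∪ R) R Q w {q}) (hcard : 2 ≤ Q.card) :
      Branch G B {u, w}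

theorem IsOddCycleGraph.exists_branch (hG : IsOddCycleGraph G) {S : Finset V} (hS : ConnOn G S)
    {v x : V} (hv : v ∈ S) (hx : x ∈ S) (hxv : x ≠ v) :
    ∃ A B N, Hang G S A B v N ∧ Branch G B N := by
  obtain ⟨A, B, N, hH, -, u, huN⟩ := hS.exists_hang hv hx hxv
  refine ⟨A, B, N, hH, ?_⟩
  obtain ⟨huB, hvu⟩ := hH.mem_nbrs.1 huN
  have hvB : v ∉ B := Finset.disjoint_left.1 hH.disj hH.mem
  have hcard : N.card ≤ 2 := hH.nbrs ▸ hG.card_neighbors_le_two hH.connB hvB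
  by_cases h1 : N.card ≤ 1
  · have : N = {u} := by
      rw [← hH.nbrs] at huN h1 ⊢
      exact filter_adj_eq_singleton huN h1
    subst this
    exact Branch.single u
  obtain ⟨a, b, hab, rfl⟩ := Finset.card_eq_two.1 (show N.card = 2 by omega)
  clear huN huB hvu h1 hcard u
  obtain ⟨haB, hva⟩ := hH.mem_nbrs.1 (Finset.mem_insert_self a {b})
  obtain ⟨hbB, hvb⟩ := hH.mem_nbrs.1 (Finset.mem_insert_of_mem (Finset.mem_singleton_self b))
  -- Both `a` and `b` see the outside set `{v}`, so the component of `b` in `B - a` hangs at `a` by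
  -- one edge `a p`.
  obtain ⟨P, D, p, hP, hbD⟩ := hG.exists_bridge hH.connB (connOn_singleton v)
    (Finset.disjoint_singleton_right.2 hvB) haB hbB hab.symm (Finset.mem_singleton_self v)
    (Finset.mem_singleton_self v) hva.symm hvb.symm
  obtain ⟨hpD, hap⟩ := hP.mem_nbrs.1 (Finset.mem_singleton_self p)
  have hDB : D ⊆ B := hP.union_eq ▸ Finset.subset_union_right
  by_cases hpb : p = b
  · subst hpb
    exact Branch.edge _ _ P D hP
  -- If `p ≠ b`, the same argument inside `D` with outside set `{a, v}`, seen by `b` through `v` and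
  -- by `p` through `a`, gives the bridge `b q` at the other end.
  have hE : ConnOn G ({a} ∪ {v}) := (connOn_singleton a).union (connOn_singleton v)
    (Finset.mem_singleton_self a) (Finset.mem_singleton_self v) hva.symm
  have hDE : Disjoint D ({a} ∪ {v}) := by
    rw [Finset.disjoint_union_right, Finset.disjoint_singleton_right,
      Finset.disjoint_singleton_right]
    exact ⟨Finset.disjoint_left.1 hP.disj hP.mem, fun h => hvB (hDB h)⟩
  obtain ⟨R, Q, q, hQ, hpQ⟩ := hG.exists_bridge hP.connB hE hDE hbD hpD hpb
    (e := v) (e' := a) (by simp) (by simp) hvb.symm hap.symm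
  obtain ⟨hqQ, hbq⟩ := hQ.mem_nbrs.1 (Finset.mem_singleton_self q)
  -- Otherwise `v a p b` is a four-cycle. This is what makes the middle part `Q` have at least two
  -- vertices.
  have hpq : p ≠ q := by
    rintro rfl
    refine hG.no_four_cycle hva hvb hap hbq.symm hab ?_
    rintro rfl
    exact hvB (hDB hpD)
  have hDeq : Q ∪ R = D := by rw [Finset.union_comm, hQ.union_eq]
  subst hDeq
  have hPQR := Finset.disjoint_union_right.1 hP.disj
  have hpR : p ∉ R := fun h => Finset.disjoint_left.1 hQ.disj h hpQ
  have hRP : ∀ r ∈ R, ∀ s ∈ P, ¬ G.Adj r s := by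
    intro r hr s hs hrs
    have := hP.cross s hs r (Finset.mem_union_right _ hr) hrs.symm
    subst this
    have := hP.mem_nbrs.2 ⟨Finset.mem_union_right _ hr, hrs.symm⟩
    exact hpR (Finset.mem_singleton.1 this ▸ hr)
  refine Branch.chain a b p q P Q R hab hP ⟨?_, hQ.mem, ?_, ?_, ?_, hQ.connA, ?_⟩ hQ ?_
  · rw [← hP.union_eq, Finset.union_comm, Finset.union_assoc]
  · exact Finset.disjoint_union_right.2 ⟨hPQR.2.symm, hQ.disj⟩
  · intro r hr s hs hrs
    rcases Finset.mem_union.1 hs with hs | hs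
    · exact absurd hrs (hRP r hr s hs)
    · exact hQ.cross r hr s hs hrs
  · rw [Finset.filter_union, Finset.filter_false_of_mem (hRP b hQ.mem), Finset.empty_union, hQ.nbrs]
  · exact hP.connA.union hQ.connB hP.mem hpQ hap
  · exact Finset.one_lt_card.2 ⟨p, hpQ, q, hqQ, hpq⟩

end Structure

/-! ### Real inequalities, one for each kind of branch. -/

section RealInequalities

/-- Used with `T` the weight of `B`, `b₀ = M(B-u)`, `b₁ = M(B)`. It rests on T(y-T+1) - y =
(T-1)(y-T). -/
theorem single_branch_ineq {y T b₀ b₁ : ℝ} (hT : 1 ≤ T) (hTy : T ≤ y) (hb : 0 < b₀)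
    (h : (y - T + 1) * b₀ ≤ y * b₁) : b₀ ≤ T * b₁ ∧ (b₀ = T * b₁ → T = 1 ∨ T = y) := by
  have hy : 0 < y := by linarith
  have h1 : T * ((y - T + 1) * b₀) ≤ T * (y * b₁) :=
    mul_le_mul_of_nonneg_left h (by linarith)
  have h2 : 0 ≤ (T - 1) * (y - T) := mul_nonneg (by linarith) (by linarith)
  have h3 : 0 ≤ (T - 1) * (y - T) * b₀ := mul_nonneg h2 hb.le
  constructor
  · have : y * b₀ ≤ y * (T * b₁) := by linarith
    exact le_of_mul_le_mul_left this hy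
  · intro he
    have h5 : y * b₀ = y * (T * b₁) := by rw [he]
    have h4 : (T - 1) * (y - T) * b₀ = 0 := le_antisymm (by linarith) h3
    rcases mul_eq_zero.1 ((mul_eq_zero.1 h4).resolve_right hb.ne') with h | h
    · exact Or.inl (by linarith)
    · exact Or.inr (by linarith)

/-- For a branch made of `P` and `R` joined by the bridge `u w`: `s`, `r` are their weights, the
index 0 marks removal of `u` or `w`, and `p₁ * r₁ - y⁻¹ * p₀ * r₀` is M(B). -/
theorem edge_branch_ineq {y d s r p₀ p₁ r₀ r₁ : ℝ} (hy : 1 < y) (hd : d * (y - 1) = 2)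
    (hs : 1 ≤ s) (hr : 1 ≤ r) (hsr : s + r + d ≤ y) (hp₀ : 0 < p₀) (hr₀ : 0 < r₀)
    (hp : (y - s + 1) * p₀ ≤ y * p₁) (hr' : (y - r + 1) * r₀ ≤ y * r₁) :
    p₀ * r₁ + r₀ * p₁ ≤ (s + r + d) * (p₁ * r₁ - y⁻¹ * p₀ * r₀) ∧
      (p₀ * r₁ + r₀ * p₁ = (s + r + d) * (p₁ * r₁ - y⁻¹ * p₀ * r₀) →
        (s = 1 ∧ r = 1) ∨ s + r + d = y) := by
  have hy0 : 0 < y := by linarith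
  have hd0 : 0 < d := by
    by_contra hcon
    nlinarith
  obtain ⟨ε, hε, hpe⟩ : ∃ ε, 0 ≤ ε ∧ y * p₁ = (y - s + 1) * p₀ + ε :=
    ⟨y * p₁ - (y - s + 1) * p₀, by linarith, by ring⟩
  obtain ⟨η, hη, hre⟩ : ∃ η, 0 ≤ η ∧ y * r₁ = (y - r + 1) * r₀ + η :=
    ⟨y * r₁ - (y - r + 1) * r₀, by linarith, by ring⟩
  set δ := s + r + d with hδ
  -- After `p₁` and `r₁` are replaced by their lower bounds plus slacks `ε`, `η`, every term is
  -- nonnegative; the relation between `d` and `y` is needed for the coefficient of `p₀ * r₀`.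
  have key : y * (y * (δ * (p₁ * r₁ - y⁻¹ * p₀ * r₀) - (p₀ * r₁ + r₀ * p₁))) =
      p₀ * r₀ * (y * ((y - δ) * (s + r - 2)) + δ * ((s - 1) * (r - 1))) +
      ε * r₀ * (δ * (y - r + 1) - y) + η * p₀ * (δ * (y - s + 1) - y) + δ * (ε * η) := by
    have e1 : y * (y * (δ * (p₁ * r₁ - y⁻¹ * p₀ * r₀) - (p₀ * r₁ + r₀ * p₁))) =
        δ * ((y * p₁) * (y * r₁) - (y * y⁻¹) * y * p₀ * r₀) - y * (p₀ * (y * r₁) + r₀ * (y * p₁)) := by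
      ring
    rw [e1, hpe, hre, mul_inv_cancel₀ hy0.ne', hδ]
    linear_combination (p₀ * r₀ * y) * hd
  have t1 : 0 ≤ (y - δ) * (s + r - 2) := mul_nonneg (by linarith) (by linarith)
  have t2 : 0 ≤ (s - 1) * (r - 1) := mul_nonneg (by linarith) (by linarith)
  have hδ0 : 0 < δ := by linarith
  have t3 : 0 ≤ δ * (y - r + 1) - y := by
    have : 0 ≤ (r - 1) * (y - r - 1) := mul_nonneg (by linarith) (by linarith)
    nlinarith
  have t4 : 0 ≤ δ * (y - s + 1) - y := by
    have : 0 ≤ (s - 1) * (y - s - 1) := mul_nonneg (by linarith) (by linarith)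
    nlinarith
  have hpr : 0 < p₀ * r₀ := mul_pos hp₀ hr₀
  have u1 : 0 ≤ p₀ * r₀ * (δ * ((s - 1) * (r - 1))) := by positivity
  have u2 : 0 ≤ ε * r₀ * (δ * (y - r + 1) - y) := by positivity
  have u3 : 0 ≤ η * p₀ * (δ * (y - s + 1) - y) := by positivity
  have u4 : 0 ≤ δ * (ε * η) := by positivity
  have u5 : 0 ≤ p₀ * r₀ * (y * ((y - δ) * (s + r - 2))) := by positivity
  constructor
  · by_contra hcon
    have : y * (y * (δ * (p₁ * r₁ - y⁻¹ * p₀ * r₀) - (p₀ * r₁ + r₀ * p₁))) < 0 :=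
      mul_neg_of_pos_of_neg hy0 (mul_neg_of_pos_of_neg hy0 (by linarith))
    linarith
  · intro he
    rw [he, sub_self, mul_zero, mul_zero] at key
    have : p₀ * r₀ * (y * ((y - δ) * (s + r - 2))) = 0 := by linarith
    have h1 := (mul_eq_zero.1 ((mul_eq_zero.1 this).resolve_left hpr.ne')).resolve_left hy0.ne'
    rcases mul_eq_zero.1 h1 with h | h
    · exact Or.inr (by linarith)
    · exact Or.inl ⟨by linarith, by linarith⟩

/-- One end of a chain: `s` is the weight of the side cut off by the end bridge, `c` that of the
rest. In the variable z = y - s - c > 0 the decisive polynomial is visibly positive. -/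
theorem chain_branch_ineq {y s c p₀ p₁ q₀ q₁ : ℝ} (hs : 1 ≤ s) (hc : 1 ≤ c) (hsc : s + c < y)
    (hp₀ : 0 < p₀) (hq₀ : 0 < q₀) (hp : (y - s + 1) * p₀ ≤ y * p₁)
    (hq : (y - c + 1) * q₀ ≤ y * q₁) : p₀ * q₁ < (s + 1) * (p₁ * q₁ - y⁻¹ * p₀ * q₀) := by
  obtain ⟨z, rfl⟩ : ∃ z, y = z + s + c := ⟨y - s - c, by ring⟩
  have hz : 0 < z := by linarith
  set y := z + s + c with hy
  have hy0 : 0 < y := by linarith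
  have hk : 0 < y - c + 1 := by linarith
  have hq₁ : 0 < q₁ := by
    by_contra hcon
    nlinarith [mul_pos hk hq₀]
  have key : 0 < (s + 1) * ((y - s + 1) * (y - c + 1) - y) - y * (y - c + 1) := by
    have : (s + 1) * ((y - s + 1) * (y - c + 1) - y) - y * (y - c + 1) =
        s * z ^ 2 + z * (s ^ 2 + s * c) + (s + 1) * ((s - 1) * (c - 1)) := by
      rw [hy]; ring
    rw [this]
    have : 0 ≤ (s - 1) * (c - 1) := mul_nonneg (by linarith) (by linarith)
    positivity
  have h1 : (y - s + 1) * p₀ * q₁ * (y - c + 1) ≤ y * p₁ * q₁ * (y - c + 1) := by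
    have := mul_le_mul_of_nonneg_right hp (mul_pos hq₁ hk).le
    linarith
  have h2 : p₀ * ((y - c + 1) * q₀) ≤ p₀ * (y * q₁) := mul_le_mul_of_nonneg_left hq hp₀.le
  have h3 : 0 < p₀ * q₁ * ((s + 1) * ((y - s + 1) * (y - c + 1) - y) - y * (y - c + 1)) := by
    positivity
  have h4 : (s + 1) * ((y - s + 1) * p₀ * q₁ * (y - c + 1) - p₀ * (y * q₁)) ≤
      (s + 1) * (y * p₁ * q₁ * (y - c + 1) - p₀ * ((y - c + 1) * q₀)) :=
    mul_le_mul_of_nonneg_left (by linarith) (by linarith)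
  have h5 : y * (y - c + 1) * ((s + 1) * (p₁ * q₁ - y⁻¹ * p₀ * q₀)) =
      (s + 1) * (y * p₁ * q₁ * (y - c + 1) - p₀ * ((y - c + 1) * q₀)) := by
    have : y * (y - c + 1) * ((s + 1) * (p₁ * q₁ - y⁻¹ * p₀ * q₀)) =
      (s + 1) * (y * p₁ * q₁ * (y - c + 1) - (y * y⁻¹) * p₀ * ((y - c + 1) * q₀)) := by ring
    rw [this, mul_inv_cancel₀ hy0.ne', one_mul]
  have h6 : y * (y - c + 1) * (p₀ * q₁) <
      y * (y - c + 1) * ((s + 1) * (p₁ * q₁ - y⁻¹ * p₀ * q₀)) := by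
    rw [h5]; linarith
  exact lt_of_mul_lt_mul_left h6 (by positivity)

end RealInequalities

/-! ### Weights and the rooted estimate. -/

section Weights

open scoped Classical

variable {V : Type*} {G : SimpleGraph V}

theorem ConnOn.exists_adj {S : Finset V} (hS : ConnOn G S) {u w : V} (hu : u ∈ S) (hw : w ∈ S)
    (hwu : w ≠ u) : ∃ x ∈ S, G.Adj u x := by
  obtain ⟨A, B, N, hH, -, x, hx⟩ := hS.exists_hang hu hw hwu
  obtain ⟨hxB, hux⟩ := hH.mem_nbrs.1 hx
  exact ⟨x, hH.union_eq ▸ Finset.mem_union_right _ hxB, hux⟩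

/-- The size-type parameter `|S| + d (e(S) - |S| + 1)` of a vertex set. -/
noncomputable def weight (G : SimpleGraph V) (d : ℝ) (S : Finset V) : ℝ :=
  S.card + d * ((degSum G S : ℝ) / 2 - S.card + 1)

theorem Hang.card_eq {S A B N : Finset V} {v : V} (h : Hang G S A B v N) :
    S.card = A.card + B.card := by
  rw [← h.union_eq, Finset.card_union_of_disjoint h.disj]

theorem Hang.degSum_eq {S A B N : Finset V} {v : V} (h : Hang G S A B v N) :
    degSum G S = degSum G A + degSum G B + 2 * N.card := by
  rw [← h.union_eq, degSum_glue h.mem h.disj h.cross, h.nbrs]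

/-- Joining two connected parts by |N| edges raises the cycle rank by |N| - 1. -/
theorem Hang.weight_eq {S A B N : Finset V} {v : V} (h : Hang G S A B v N) (d : ℝ) :
    weight G d S = weight G d A + weight G d B + d * (N.card - 1) := by
  unfold weight
  rw [h.card_eq, h.degSum_eq]
  push_cast
  ring

theorem ConnOn.two_mul_card_le {S : Finset V} (hS : ConnOn G S) :
    2 * S.card ≤ degSum G S + 2 := by
  induction S using Finset.strongInduction with
  | H S ih =>
    obtain ⟨v, hv⟩ := hS.1
    by_cases h : ∃ w ∈ S, w ≠ v
    · obtain ⟨w, hw, hwv⟩ := h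
      obtain ⟨A, B, N, hH, hwB, hN⟩ := hS.exists_hang hv hw hwv
      have hA : A.card < S.card := by
        have := hH.card_eq
        have := Finset.card_pos.2 ⟨w, hwB⟩
        omega
      have hB : B.card < S.card := by
        have := hH.card_eq
        have := Finset.card_pos.2 ⟨v, hH.mem⟩
        omega
      have h1 := ih A ((hH.union_eq ▸ Finset.subset_union_left).ssubset_of_ne
        (by rintro rfl; exact hA.ne rfl)) hH.connA
      have h2 := ih B ((hH.union_eq ▸ Finset.subset_union_right).ssubset_of_ne
        (by rintro rfl; exact hB.ne rfl)) hH.connB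
      have h3 := Finset.card_pos.2 hN
      have := hH.card_eq
      have := hH.degSum_eq
      omega
    · push Not at h
      have : S.card ≤ 1 := Finset.card_le_one.2 fun a ha b hb => (h a ha).trans (h b hb).symm
      omega

theorem ConnOn.card_le_weight {S : Finset V} (hS : ConnOn G S) {d : ℝ} (hd : 0 ≤ d) :
    (S.card : ℝ) ≤ weight G d S := by
  have h : (2 * S.card : ℝ) ≤ degSum G S + 2 := by exact_mod_cast hS.two_mul_card_le
  have : 0 ≤ d * ((degSum G S : ℝ) / 2 - S.card + 1) := mul_nonneg hd (by linarith)
  unfold weight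
  linarith

theorem ConnOn.one_le_weight {S : Finset V} (hS : ConnOn G S) {d : ℝ} (hd : 0 ≤ d) :
    1 ≤ weight G d S := by
  have h1 : (1 : ℝ) ≤ S.card := by exact_mod_cast Finset.card_pos.2 hS.1
  exact h1.trans (hS.card_le_weight hd)

theorem ConnOn.eq_singleton_of_weight {S : Finset V} (hS : ConnOn G S) {d : ℝ} (hd : 0 ≤ d)
    (h : weight G d S = 1) {v : V} (hv : v ∈ S) : S = {v} := by
  have h1 : (S.card : ℝ) ≤ 1 := h ▸ hS.card_le_weight hd
  have h2 : S.card ≤ 1 := by exact_mod_cast h1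
  exact Finset.eq_singleton_iff_unique_mem.2 ⟨hv, fun w hw => Finset.card_le_one.1 h2 w hw v hv⟩

theorem Branch.one_le_card {B N : Finset V} (h : Branch G B N) : (1 : ℝ) ≤ N.card := by
  cases h with
  | single u => simp
  | edge u w => exact_mod_cast Finset.card_pos.2 ⟨u, Finset.mem_insert_self _ _⟩
  | chain u w => exact_mod_cast Finset.card_pos.2 ⟨u, Finset.mem_insert_self _ _⟩

variable [Fintype V]

theorem Hang.matchingSum_eq {S A B N : Finset V} {v : V} (h : Hang G S A B v N) (z : ℝ) :
    matchingSum G z S = matchingSum G z A * matchingSum G z B -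
      z * matchingSum G z (A.erase v) * ∑ u ∈ N, matchingSum G z (B.erase u) := by
  rw [← h.union_eq, matchingSum_glue z h.mem h.disj h.cross, h.nbrs]

theorem Hang.matchingSum_erase {S A B N : Finset V} {v : V} (h : Hang G S A B v N) (z : ℝ) :
    matchingSum G z (S.erase v) = matchingSum G z (A.erase v) * matchingSum G z B := by
  rw [← h.union_eq, matchingSum_glue_erase z h.mem h.disj h.cross]

/-- The defect of the rooted estimate at `v` is a sum of a term for `A` and a term for the branch
`B`, so branches can be treated one at a time and equality forces both terms to vanish. -/
theorem Hang.defect_eq {S A B N : Finset V} {v : V} (h : Hang G S A B v N) {y : ℝ} (hy : y ≠ 0)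
    (d : ℝ) : y * matchingSum G y⁻¹ S - (y - weight G d S + 1) * matchingSum G y⁻¹ (S.erase v) =
      (y * matchingSum G y⁻¹ A -
        (y - weight G d A + 1) * matchingSum G y⁻¹ (A.erase v)) * matchingSum G y⁻¹ B +
      matchingSum G y⁻¹ (A.erase v) *
        ((weight G d B + d * (N.card - 1)) * matchingSum G y⁻¹ B -
          ∑ u ∈ N, matchingSum G y⁻¹ (B.erase u)) := by
  rw [h.matchingSum_eq, h.matchingSum_erase, h.weight_eq]
  linear_combination (-(matchingSum G y⁻¹ (A.erase v)) *
    ∑ u ∈ N, matchingSum G y⁻¹ (B.erase u)) * mul_inv_cancel₀ hy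

/-- The rooted estimate: `S - v` has positive matching sum, the ratio of the matching sums of
`S - v` and `S` is controlled by the weight of `S`, and below the critical weight equality forces
`v` to be adjacent to all of `S`. -/
def RootBound (G : SimpleGraph V) (y d : ℝ) (S : Finset V) : Prop :=
  ∀ v ∈ S, 0 < matchingSum G y⁻¹ (S.erase v) ∧
    (y - weight G d S + 1) * matchingSum G y⁻¹ (S.erase v) ≤ y * matchingSum G y⁻¹ S ∧
    (weight G d S < y + 1 →
      (y - weight G d S + 1) * matchingSum G y⁻¹ (S.erase v) = y * matchingSum G y⁻¹ S →
      ∀ w ∈ S, w ≠ v → G.Adj v w)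

theorem RootBound.pos {y d : ℝ} {S : Finset V} (h : RootBound G y d S) (hS : S.Nonempty)
    (hy : 0 < y) (hw : weight G d S < y + 1) : 0 < matchingSum G y⁻¹ S := by
  obtain ⟨v, hv⟩ := hS
  obtain ⟨h1, h2, -⟩ := h v hv
  have : 0 < (y - weight G d S + 1) * matchingSum G y⁻¹ (S.erase v) :=
    mul_pos (by linarith) h1
  exact pos_of_mul_pos_right (this.trans_le h2) hy.le

/-- The contribution of a branch to the recursion at the vertex it hangs from. -/
theorem branch_bound {y d : ℝ} (hy : 1 < y) (hd : d * (y - 1) = 2) {S A B N : Finset V} {v : V}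
    (hH : Hang G S A B v N) (hbr : Branch G B N)
    (ih : ∀ C, C.card < S.card → ConnOn G C → weight G d C ≤ y + 1 → RootBound G y d C)
    (hw : weight G d B + d * (N.card - 1) ≤ y) :
    0 < matchingSum G y⁻¹ B ∧
    ∑ u ∈ N, matchingSum G y⁻¹ (B.erase u) ≤
      (weight G d B + d * (N.card - 1)) * matchingSum G y⁻¹ B ∧
    (∑ u ∈ N, matchingSum G y⁻¹ (B.erase u) =
        (weight G d B + d * (N.card - 1)) * matchingSum G y⁻¹ B →
      B ⊆ N ∨ (weight G d B + d * (N.card - 1) = y ∧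
        ∃ u ∈ B, N.card < (S.filter (G.Adj u)).card)) := by
  have hy0 : 0 < y := by linarith
  have hd0 : 0 < d := by
    by_contra hcon
    nlinarith
  have hvB : v ∉ B := Finset.disjoint_left.1 hH.disj hH.mem
  have hBS : B.card < S.card := by
    have := hH.card_eq
    have := Finset.card_pos.2 ⟨v, hH.mem⟩
    omega
  have hvS : v ∈ S := hH.union_eq ▸ Finset.mem_union_left _ hH.mem
  have hsub : B ⊆ S := hH.union_eq ▸ Finset.subset_union_right
  cases hbr with
  | single u =>
    simp only [Finset.card_singleton, Nat.cast_one, sub_self, mul_zero, add_zero,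
      Finset.sum_singleton] at hw ⊢
    obtain ⟨huB, hvu⟩ := hH.mem_nbrs.1 (Finset.mem_singleton_self u)
    have hRB := ih B hBS hH.connB (by linarith)
    obtain ⟨h1, h2, -⟩ := hRB u huB
    obtain ⟨h3, h4⟩ := single_branch_ineq (hH.connB.one_le_weight hd0.le) hw h1 h2
    refine ⟨hRB.pos hH.connB.1 hy0 (by linarith), h3, fun he => ?_⟩
    rcases h4 he with h | h
    · left
      rw [← hH.connB.eq_singleton_of_weight hd0.le h huB]
    -- In the critical case a larger branch gives `u` a neighbour inside `B` besides `v`, hence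
    -- degree above |N| = 1.
    · by_cases hBu : B ⊆ {u}
      · exact Or.inl hBu
      · right
        refine ⟨h, u, huB, ?_⟩
        obtain ⟨w, hwB, hwu⟩ := Finset.not_subset.1 hBu
        obtain ⟨x, hxB, hux⟩ := hH.connB.exists_adj huB hwB (by simpa using hwu)
        refine Finset.one_lt_card.2 ⟨v, by simpa using ⟨hvS, hvu.symm⟩, x,
          by simpa using ⟨hsub hxB, hux⟩, ?_⟩
        rintro rfl
        exact hvB hxB
  | edge u w P R h =>
    have huw : u ≠ w := by
      rintro rfl
      exact Finset.disjoint_left.1 h.disj h.mem (h.mem_nbrs.1 (Finset.mem_singleton_self _)).1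
    obtain ⟨hwR, huwadj⟩ := h.mem_nbrs.1 (Finset.mem_singleton_self w)
    have huB : u ∈ B := h.union_eq ▸ Finset.mem_union_left _ h.mem
    have hwB : w ∈ B := h.union_eq ▸ Finset.mem_union_right _ hwR
    have hvu := (hH.mem_nbrs.1 (Finset.mem_insert_self u {w})).2
    have hvw := (hH.mem_nbrs.1 (Finset.mem_insert_of_mem (Finset.mem_singleton_self w))).2
    have hcard : (({u, w} : Finset V).card : ℝ) - 1 = 1 := by
      rw [Finset.card_pair huw]; norm_num
    rw [hcard] at hw ⊢
    have hwt := h.weight_eq d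
    simp only [Finset.card_singleton, Nat.cast_one, sub_self, mul_zero, add_zero] at hwt
    have hP1 := h.connA.one_le_weight hd0.le
    have hR1 := h.connB.one_le_weight hd0.le
    have hPc := Finset.card_pos.2 h.connA.1
    have hRc := Finset.card_pos.2 h.connB.1
    have hBc := h.card_eq
    have hBP := ih B hBS hH.connB (by linarith)
    obtain ⟨p1, p2, -⟩ := ih P (by omega) h.connA (by linarith) u h.mem
    obtain ⟨r1, r2, -⟩ := ih R (by omega) h.connB (by linarith) w hwR
    have hsum : ∑ x ∈ {u, w}, matchingSum G y⁻¹ (B.erase x) =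
        matchingSum G y⁻¹ (P.erase u) * matchingSum G y⁻¹ R +
        matchingSum G y⁻¹ (R.erase w) * matchingSum G y⁻¹ P := by
      rw [Finset.sum_pair huw, h.matchingSum_erase, h.symm.matchingSum_erase]
    have hB' : matchingSum G y⁻¹ B = matchingSum G y⁻¹ P * matchingSum G y⁻¹ R -
        y⁻¹ * matchingSum G y⁻¹ (P.erase u) * matchingSum G y⁻¹ (R.erase w) := by
      rw [h.matchingSum_eq, Finset.sum_singleton]
    have hδ : weight G d B + d * 1 = weight G d P + weight G d R + d := by rw [hwt, mul_one]
    rw [hδ] at hw ⊢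
    obtain ⟨k1, k2⟩ := edge_branch_ineq hy hd hP1 hR1 hw p1 r1 p2 r2
    refine ⟨hBP.pos hH.connB.1 hy0 (by linarith), by rw [hsum, hB']; exact k1, fun he => ?_⟩
    rw [hsum, hB'] at he
    rcases k2 he with ⟨hs, hr⟩ | hdy
    · left
      rw [← h.union_eq, h.connA.eq_singleton_of_weight hd0.le hs h.mem,
        h.connB.eq_singleton_of_weight hd0.le hr hwR, Finset.singleton_union]
    · by_cases hBN : B ⊆ {u, w}
      · exact Or.inl hBN
      · right
        refine ⟨hdy, ?_⟩
        rw [Finset.card_pair huw]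
        obtain ⟨x, hxB, hx⟩ := Finset.not_subset.1 hBN
        simp only [Finset.mem_insert, Finset.mem_singleton, not_or] at hx
        rcases Finset.mem_union.1 (h.union_eq ▸ hxB : x ∈ P ∪ R) with hxP | hxR
        · obtain ⟨t, htP, hut⟩ := h.connA.exists_adj h.mem hxP hx.1
          have htB : t ∈ B := h.union_eq ▸ Finset.mem_union_left _ htP
          refine ⟨u, huB, Finset.two_lt_card.2 ⟨v, by simpa using ⟨hvS, hvu.symm⟩, w,
            by simpa using ⟨hsub hwB, huwadj⟩, t, by simpa using ⟨hsub htB, hut⟩, ?_, ?_, ?_⟩⟩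
          · rintro rfl; exact hvB hwB
          · rintro rfl; exact hvB htB
          · rintro rfl; exact Finset.disjoint_left.1 h.disj htP hwR
        · obtain ⟨t, htR, hwt'⟩ := h.connB.exists_adj hwR hxR hx.2
          have htB : t ∈ B := h.union_eq ▸ Finset.mem_union_right _ htR
          refine ⟨w, hwB, Finset.two_lt_card.2 ⟨v, by simpa using ⟨hvS, hvw.symm⟩, u,
            by simpa using ⟨hsub huB, huwadj.symm⟩, t, by simpa using ⟨hsub htB, hwt'⟩, ?_, ?_, ?_⟩⟩
          · rintro rfl; exact hvB huB
          · rintro rfl; exact hvB htB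
          · rintro rfl; exact Finset.disjoint_left.1 h.disj h.mem htR
  | chain u w p q P Q R huw hP hR hQ hQc =>
    have hcard : (({u, w} : Finset V).card : ℝ) - 1 = 1 := by
      rw [Finset.card_pair huw]; norm_num
    rw [hcard] at hw ⊢
    have w1 := hP.weight_eq d
    have w2 := hR.weight_eq d
    have w3 := hQ.weight_eq d
    simp only [Finset.card_singleton, Nat.cast_one, sub_self, mul_zero, add_zero] at w1 w2 w3
    have hP1 := hP.connA.one_le_weight hd0.le
    have hR1 := hR.connA.one_le_weight hd0.le
    have hPQ1 := hR.connB.one_le_weight hd0.le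
    have hQR1 := hP.connB.one_le_weight hd0.le
    have hQ2 : (2 : ℝ) ≤ weight G d Q :=
      le_trans (by exact_mod_cast hQc) (hQ.connB.card_le_weight hd0.le)
    have c1 := hP.card_eq
    have c2 := hR.card_eq
    have d1 := Finset.card_pos.2 hP.connA.1
    have d2 := Finset.card_pos.2 hP.connB.1
    have d3 := Finset.card_pos.2 hR.connA.1
    have d4 := Finset.card_pos.2 hR.connB.1
    have hpD := (hP.mem_nbrs.1 (Finset.mem_singleton_self p)).1
    have hqD := (hR.mem_nbrs.1 (Finset.mem_singleton_self q)).1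
    obtain ⟨a1, a2, -⟩ := ih P (by omega) hP.connA (by linarith) u hP.mem
    obtain ⟨b1, b2, -⟩ := ih (Q ∪ R) (by omega) hP.connB (by linarith) p hpD
    obtain ⟨e1, e2, -⟩ := ih R (by omega) hR.connA (by linarith) w hR.mem
    obtain ⟨f1, f2, -⟩ := ih (P ∪ Q) (by omega) hR.connB (by linarith) q hqD
    -- The two end bridges give strict bounds with factors one above the weights of `P` and `R`; the
    -- two extra units are paid for by the weight of `Q`, which is at least 2.
    have k1 := chain_branch_ineq hP1 hQR1 (by linarith) a1 b1 a2 b2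
    have k2 := chain_branch_ineq hR1 hPQ1 (by linarith) e1 f1 e2 f2
    have hB1 := hP.matchingSum_eq y⁻¹
    have hB2 := hR.matchingSum_eq y⁻¹
    rw [Finset.sum_singleton] at hB1 hB2
    rw [← hB1, ← hP.matchingSum_erase] at k1
    rw [← hB2, ← hR.matchingSum_erase] at k2
    have hpos : 0 < matchingSum G y⁻¹ B :=
      (ih B hBS hH.connB (by linarith)).pos hH.connB.1 hy0 (by linarith)
    have hlt : ∑ x ∈ {u, w}, matchingSum G y⁻¹ (B.erase x) <
        (weight G d B + d * 1) * matchingSum G y⁻¹ B := by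
      rw [Finset.sum_pair huw]
      have : (weight G d P + 1 + (weight G d R + 1)) * matchingSum G y⁻¹ B ≤
          (weight G d B + d * 1) * matchingSum G y⁻¹ B :=
        mul_le_mul_of_nonneg_right (by linarith) hpos.le
      linarith
    exact ⟨hpos, hlt.le, fun he => absurd he hlt.ne⟩

theorem IsOddCycleGraph.rootBound (hG : IsOddCycleGraph G) {y d : ℝ} (hy : 1 < y)
    (hd : d * (y - 1) = 2) (n : ℕ) : ∀ S : Finset V, S.card = n → ConnOn G S →
      weight G d S ≤ y + 1 → RootBound G y d S := by
  have hy0 : 0 < y := by linarith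
  have hd0 : 0 < d := by
    by_contra hcon
    nlinarith
  induction n using Nat.strong_induction_on with
  | _ n ihn =>
    intro S hSn hS hw v hv
    have ih : ∀ C, C.card < S.card → ConnOn G C → weight G d C ≤ y + 1 → RootBound G y d C :=
      fun C hC => ihn C.card (hSn ▸ hC) C rfl
    by_cases hx : ∃ x ∈ S, x ≠ v
    · obtain ⟨x, hxS, hxv⟩ := hx
      obtain ⟨A, B, N, hH, hbr⟩ := hG.exists_branch hS hv hxS hxv
      have hwt := hH.weight_eq d
      have hA1 := hH.connA.one_le_weight hd0.le
      have hB1 := hH.connB.one_le_weight hd0.le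
      have hNc := hbr.one_le_card
      have hdN : 0 ≤ d * ((N.card : ℝ) - 1) := mul_nonneg hd0.le (by linarith)
      obtain ⟨hBpos, hB, hBe⟩ := branch_bound hy hd hH hbr ih (by linarith)
      have hAS : A.card < S.card := by
        have := hH.card_eq
        have := Finset.card_pos.2 hH.connB.1
        omega
      obtain ⟨a1, a2, a3⟩ := ih A hAS hH.connA (by linarith) v hH.mem
      have hpos : 0 < matchingSum G y⁻¹ (S.erase v) := by
        rw [hH.matchingSum_erase]
        exact mul_pos a1 hBpos
      have t1 : 0 ≤ (y * matchingSum G y⁻¹ A -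
          (y - weight G d A + 1) * matchingSum G y⁻¹ (A.erase v)) * matchingSum G y⁻¹ B :=
        mul_nonneg (by linarith) hBpos.le
      have t2 : 0 ≤ matchingSum G y⁻¹ (A.erase v) *
          ((weight G d B + d * (N.card - 1)) * matchingSum G y⁻¹ B -
            ∑ u ∈ N, matchingSum G y⁻¹ (B.erase u)) := mul_nonneg a1.le (by linarith)
      have key := hH.defect_eq hy0.ne' d
      refine ⟨hpos, by linarith, fun hlt he w hwS hwv => ?_⟩
      have z1 := (mul_eq_zero.1 (by linarith : (y * matchingSum G y⁻¹ A -
          (y - weight G d A + 1) * matchingSum G y⁻¹ (A.erase v)) * matchingSum G y⁻¹ B = 0)).resolve_right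
          hBpos.ne'
      have z2 := (mul_eq_zero.1 (by linarith : matchingSum G y⁻¹ (A.erase v) *
          ((weight G d B + d * (N.card - 1)) * matchingSum G y⁻¹ B -
            ∑ u ∈ N, matchingSum G y⁻¹ (B.erase u)) = 0)).resolve_left a1.ne'
      rw [← hH.union_eq] at hwS
      rcases Finset.mem_union.1 hwS with hwA | hwB
      · exact a3 (by linarith) (by linarith) w hwA hwv
      · rcases hBe (by linarith) with h | ⟨h, -⟩
        · exact (hH.mem_nbrs.1 (h hwB)).2
        -- A branch contributing `y` and an `A` of weight at least 1 would bring `S` to weight `y +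
        -- 1`.
        · exact absurd h (by linarith)
    · push Not at hx
      obtain rfl : S = {v} := Finset.eq_singleton_iff_unique_mem.2 ⟨hv, hx⟩
      have hw1 : weight G d {v} = 1 := by simp [weight, degSum_singleton]
      rw [hw1, matchingSum_singleton, Finset.erase_singleton, matchingSum_empty]
      exact ⟨one_pos, by linarith, fun _ _ w hw' hwv => absurd (Finset.mem_singleton.1 hw') hwv⟩

/-- A connected set of critical weight with vanishing matching sum has a dominating vertex. -/
theorem IsOddCycleGraph.exists_dominating (hG : IsOddCycleGraph G) {y d : ℝ} (hy : 1 < y)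
    (hd : d * (y - 1) = 2) {S : Finset V} (hS : ConnOn G S) (hw : weight G d S = y + 1)
    (h0 : matchingSum G y⁻¹ S = 0) : ∃ c ∈ S, ∀ w ∈ S, w ≠ c → G.Adj c w := by
  have hy0 : 0 < y := by linarith
  have hd0 : 0 < d := by
    by_contra hcon
    nlinarith
  -- At critical weight equality alone does not make every root dominating. Maximal degree rules out
  -- the second alternative of `branch_bound`.
  obtain ⟨v, hv, hmax⟩ := S.exists_max_image (fun u => (S.filter (G.Adj u)).card) hS.1
  refine ⟨v, hv, ?_⟩
  intro w hwS hwv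
  obtain ⟨A, B, N, hH, hbr⟩ := hG.exists_branch hS hv hwS hwv
  have hwt := hH.weight_eq d
  have hA1 := hH.connA.one_le_weight hd0.le
  have hB1 := hH.connB.one_le_weight hd0.le
  have hNc := hbr.one_le_card
  have hdN : 0 ≤ d * ((N.card : ℝ) - 1) := mul_nonneg hd0.le (by linarith)
  obtain ⟨hBpos, hB, hBe⟩ := branch_bound hy hd hH hbr
    (fun C _ hC hwC => hG.rootBound hy hd _ C rfl hC hwC) (by linarith)
  obtain ⟨a1, a2, a3⟩ := hG.rootBound hy hd _ A rfl hH.connA (by linarith) v hH.mem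
  have t1 : 0 ≤ (y * matchingSum G y⁻¹ A -
      (y - weight G d A + 1) * matchingSum G y⁻¹ (A.erase v)) * matchingSum G y⁻¹ B :=
    mul_nonneg (by linarith) hBpos.le
  have t2 : 0 ≤ matchingSum G y⁻¹ (A.erase v) *
      ((weight G d B + d * (N.card - 1)) * matchingSum G y⁻¹ B -
        ∑ u ∈ N, matchingSum G y⁻¹ (B.erase u)) := mul_nonneg a1.le (by linarith)
  have key := hH.defect_eq hy0.ne' d
  rw [h0, hw, mul_zero, sub_add_cancel_left, neg_add_cancel, zero_mul, sub_zero] at key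
  have z1 := (mul_eq_zero.1 (by linarith : (y * matchingSum G y⁻¹ A -
      (y - weight G d A + 1) * matchingSum G y⁻¹ (A.erase v)) * matchingSum G y⁻¹ B = 0)).resolve_right
      hBpos.ne'
  have z2 := (mul_eq_zero.1 (by linarith : matchingSum G y⁻¹ (A.erase v) *
      ((weight G d B + d * (N.card - 1)) * matchingSum G y⁻¹ B -
        ∑ u ∈ N, matchingSum G y⁻¹ (B.erase u)) = 0)).resolve_left a1.ne'
  rw [← hH.union_eq] at hwS
  rcases Finset.mem_union.1 hwS with hwA | hwB
  · exact a3 (by linarith) (by linarith) w hwA hwv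
  · rcases hBe (by linarith) with h | ⟨h, u, huB, hu⟩
    · exact (hH.mem_nbrs.1 (h hwB)).2
    -- The branch uses up all the weight but 1, so `v` has only the |N| neighbours in `B`, fewer
    -- than `u` has.
    · have hA : A = {v} := hH.connA.eq_singleton_of_weight hd0.le (by linarith) hH.mem
      have hdeg : S.filter (G.Adj v) = N := by
        rw [← hH.union_eq, hA, Finset.filter_union, hH.nbrs, Finset.filter_singleton]
        simp
      have := hmax u (hH.union_eq ▸ Finset.mem_union_right _ huB)
      rw [hdeg] at this
      omega

end Weights

/-! ### The largest matching root as a zero of the matching sum. -/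

section Roots

open scoped Classical

variable {V : Type*} {G : SimpleGraph V}

theorem exists_connOn_component {S : Finset V} {v : V} (hv : v ∈ S) :
    ∃ B ⊆ S, v ∈ B ∧ ConnOn G B ∧ ∀ b ∈ B, ∀ a ∈ S \ B, ¬ G.Adj b a := by
  set B : Finset V := S.filter fun z => ∃ p : G.Walk v z, ∀ t ∈ p.support, t ∈ S with hB
  have hvB : v ∈ B :=
    Finset.mem_filter.2 ⟨hv, SimpleGraph.Walk.nil, by simpa using hv⟩
  refine ⟨B, Finset.filter_subset _ _, hvB, ConnOn.of_base hvB fun a ha => ?_, ?_⟩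
  · obtain ⟨p, hp⟩ := (Finset.mem_filter.1 ha).2
    refine ⟨p.reverse, fun z hz => ?_⟩
    have hz' : z ∈ p.support := by simpa using hz
    exact Finset.mem_filter.2 ⟨hp z hz', p.takeUntil z hz',
      fun t ht => hp t (p.support_takeUntil_subset_support hz' ht)⟩
  · intro b hb a ha hba
    obtain ⟨p, hp⟩ := (Finset.mem_filter.1 hb).2
    obtain ⟨haS, haB⟩ := Finset.mem_sdiff.1 ha
    refine haB (Finset.mem_filter.2 ⟨haS, p.concat hba, fun t ht => ?_⟩)
    rw [SimpleGraph.Walk.support_concat, List.mem_append, List.mem_singleton] at ht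
    rcases ht with ht | rfl
    · exact hp t ht
    · exact haS

variable [Fintype V]

theorem exists_connOn_of_matchingSum_eq_zero {z : ℝ} {S : Finset V}
    (h : matchingSum G z S = 0) : ∃ B, ConnOn G B ∧ matchingSum G z B = 0 := by
  induction S using Finset.strongInduction with
  | H S ih =>
    rcases S.eq_empty_or_nonempty with rfl | ⟨v, hv⟩
    · simp [matchingSum_empty] at h
    · obtain ⟨B, hBS, hvB, hB, hcross⟩ := exists_connOn_component (G := G) hv
      rw [← Finset.union_sdiff_of_subset hBS, matchingSum_union z Finset.disjoint_sdiff hcross,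
        mul_eq_zero] at h
      rcases h with h | h
      · exact ⟨B, hB, h⟩
      · exact ih _ (Finset.sdiff_ssubset hBS ⟨v, hvB⟩) h

theorem two_mul_card_le_of_independent {N : Finset (Sym2 V)} (hN : IsIndependentEdgeSet G N) :
    2 * N.card ≤ Fintype.card V := by
  have h1 : (N.biUnion Sym2.toFinset).card = ∑ e ∈ N, e.toFinset.card := by
    refine Finset.card_biUnion fun e he f hf hef => ?_
    rw [Function.onFun, Finset.disjoint_left]
    intro v hv hv'
    exact hN.2 e he f hf hef v (Sym2.mem_toFinset.1 hv) (Sym2.mem_toFinset.1 hv')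
  have h2 : ∀ e ∈ N, e.toFinset.card = 2 := fun e he =>
    Sym2.card_toFinset_of_not_isDiag e (G.not_isDiag_of_mem_edgeSet (hN.1 e he))
  rw [Finset.sum_congr rfl h2, Finset.sum_const, smul_eq_mul] at h1
  have := Finset.card_le_univ (N.biUnion Sym2.toFinset)
  omega

theorem matchingCount_eq (k : ℕ) : matchingCount G k =
    ((matchingsIn G Finset.univ).filter fun N => N.card = k).card := by
  rw [matchingCount, ← Set.ncard_coe_finset]
  congr 1
  ext N
  simp [mem_matchingsIn]

/-- Matchings are grouped by size; cutting the range at n/2 loses nothing by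
`two_mul_card_le_of_independent`. -/
theorem eval_matchingPoly {x : ℝ} (hx : x ≠ 0) : (matchingPoly G).eval x =
    x ^ Fintype.card V * matchingSum G (x ^ 2)⁻¹ Finset.univ := by
  have hmaps : ∀ N ∈ matchingsIn G Finset.univ,
      N.card ∈ Finset.range (Fintype.card V / 2 + 1) := by
    intro N hN
    have := two_mul_card_le_of_independent (mem_matchingsIn.1 hN).1
    rw [Finset.mem_range]
    omega
  rw [matchingPoly, Polynomial.eval_finsetSum, matchingSum, Nat.card_eq_fintype_card,
    ← Finset.sum_fiberwise_of_maps_to hmaps, Finset.mul_sum]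
  refine Finset.sum_congr rfl fun k hk => ?_
  have hk' : 2 * k ≤ Fintype.card V := by
    rw [Finset.mem_range] at hk
    omega
  have h1 : ∑ N ∈ matchingsIn G Finset.univ with N.card = k, (-(x ^ 2)⁻¹) ^ N.card =
      (matchingCount G k : ℝ) * (-(x ^ 2)⁻¹) ^ k := by
    rw [matchingCount_eq, ← nsmul_eq_mul, ← Finset.sum_const]
    exact Finset.sum_congr rfl fun N hN => by rw [(Finset.mem_filter.1 hN).2]
  rw [h1]
  simp only [eval_mul, eval_C, eval_pow, eval_X]
  rw [neg_pow (x ^ 2)⁻¹, inv_pow, ← pow_mul, ← Nat.sub_add_cancel hk', pow_add]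
  rw [Nat.sub_add_cancel hk']
  have : x ^ (2 * k) ≠ 0 := pow_ne_zero _ hx
  field_simp

theorem isRoot_matchingPoly_iff {x : ℝ} (hx : x ≠ 0) : (matchingPoly G).IsRoot x ↔
    matchingSum G (x ^ 2)⁻¹ Finset.univ = 0 := by
  rw [Polynomial.IsRoot.def, eval_matchingPoly hx, mul_eq_zero]
  exact or_iff_right (pow_ne_zero _ hx)

/-- The signed matching generating function as a polynomial. -/
noncomputable def matchingSumPoly (G : SimpleGraph V) (S : Finset V) : ℝ[X] :=
  ∑ N ∈ matchingsIn G S, (-X) ^ N.card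

theorem eval_matchingSumPoly (S : Finset V) (z : ℝ) :
    (matchingSumPoly G S).eval z = matchingSum G z S := by
  simp [matchingSumPoly, matchingSum, Polynomial.eval_finsetSum]

theorem matchingSum_zero (S : Finset V) : matchingSum G 0 S = 1 := by
  induction S using Finset.strongInduction with
  | H S ih =>
    rcases S.eq_empty_or_nonempty with rfl | ⟨v, hv⟩
    · exact matchingSum_empty 0
    · rw [matchingSum_rec 0 hv, ih _ (Finset.erase_ssubset hv)]
      ring

theorem matchingSumPoly_ne_zero (S : Finset V) : matchingSumPoly G S ≠ 0 := by
  intro h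
  have := eval_matchingSumPoly (G := G) S 0
  rw [h, matchingSum_zero] at this
  simp at this

theorem matchingSum_pair (z : ℝ) {u v : V} (h : G.Adj u v) :
    matchingSum G z {u, v} = 1 - z := by
  have hu : u ∈ ({u, v} : Finset V) := Finset.mem_insert_self _ _
  have e1 : ({u, v} : Finset V).erase u = {v} := by
    rw [Finset.erase_insert (by simpa using h.ne)]
  have e2 : ({u, v} : Finset V).filter (G.Adj u) = {v} := by
    rw [Finset.filter_insert, Finset.filter_singleton]
    simp [h]
  rw [matchingSum_rec z hu, e1, e2, Finset.sum_singleton, matchingSum_singleton,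
    Finset.erase_singleton, matchingSum_empty, mul_one]

/-- A graph with an edge has a least positive zero of its signed matching generating function. -/
theorem exists_least_zero {u v : V} (huv : G.Adj u v) : ∃ z : ℝ, 0 < z ∧
    matchingSum G z Finset.univ = 0 ∧
    ∀ t, 0 < t → t < z → matchingSum G t Finset.univ ≠ 0 := by
  -- Positive zeros are collected over all vertex sets at once. At the least one, `z`, no matching
  -- sum is negative, since each starts from 1 at 0 and has no zero in between.
  set Z : Finset ℝ := ((Finset.univ : Finset (Finset V)).biUnion fun S =>
    (matchingSumPoly G S).roots.toFinset).filter fun z => 0 < z with hZ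
  have hmem : ∀ z, z ∈ Z ↔ 0 < z ∧ ∃ S, matchingSum G z S = 0 := by
    intro z
    simp only [hZ, Finset.mem_filter, Finset.mem_biUnion, Finset.mem_univ, true_and,
      Multiset.mem_toFinset, Polynomial.mem_roots (matchingSumPoly_ne_zero _),
      Polynomial.IsRoot.def, eval_matchingSumPoly]
    tauto
  have hne : Z.Nonempty := ⟨1, (hmem 1).2 ⟨one_pos, {u, v}, by rw [matchingSum_pair 1 huv, sub_self]⟩⟩
  obtain ⟨hz0, hz⟩ := (hmem _).1 (Z.min'_mem hne)
  set z := Z.min' hne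
  have hmin : ∀ t, 0 < t → t < z → ∀ S, matchingSum G t S ≠ 0 := fun t ht htz S hS =>
    absurd (Z.min'_le t ((hmem t).2 ⟨ht, S, hS⟩)) (not_le.2 htz)
  have hnonneg : ∀ S, 0 ≤ matchingSum G z S := by
    intro S
    by_contra hneg
    rw [not_le] at hneg
    have hcont : ContinuousOn (fun t => matchingSum G t S) (Set.Icc 0 z) := by
      refine Continuous.continuousOn ?_
      have : (fun t => matchingSum G t S) = fun t => (matchingSumPoly G S).eval t :=
        funext fun t => (eval_matchingSumPoly S t).symm
      rw [this]
      exact (matchingSumPoly G S).continuous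
    obtain ⟨t, ht, ht0⟩ := intermediate_value_Icc' hz0.le hcont
      ⟨hneg.le, by simp [matchingSum_zero]⟩
    simp only at ht0
    have h1 : t ≠ 0 := by
      rintro rfl
      rw [matchingSum_zero] at ht0
      exact one_ne_zero ht0
    have h2 : t ≠ z := by
      rintro rfl
      exact hneg.ne ht0
    exact hmin t (lt_of_le_of_ne ht.1 h1.symm) (lt_of_le_of_ne ht.2 h2) S ht0
  refine ⟨z, hz0, ?_, fun t ht htz => hmin t ht htz _⟩
  -- A set with zero sum stays so when a vertex is added: the recurrence gives a sum ≤ 0, and it is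
  -- also ≥ 0. So a largest such set is everything.
  obtain ⟨R, hR, hRmax⟩ := (Finset.univ.filter fun S : Finset V => matchingSum G z S = 0).exists_max_image
    Finset.card (by obtain ⟨S, hS⟩ := hz; exact ⟨S, by simpa using hS⟩)
  have hR0 : matchingSum G z R = 0 := by simpa using hR
  by_cases hRu : R = Finset.univ
  · rw [← hRu, hR0]
  · obtain ⟨w, hw⟩ : ∃ w, w ∉ R := by
      by_contra hcon
      push Not at hcon
      exact hRu (Finset.eq_univ_iff_forall.2 hcon)
    have h1 : matchingSum G z (insert w R) ≤ 0 := by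
      rw [matchingSum_rec z (Finset.mem_insert_self w R), Finset.erase_insert hw, hR0, zero_sub,
        neg_nonpos]
      exact mul_nonneg hz0.le (Finset.sum_nonneg fun _ _ => hnonneg _)
    have h2 := hRmax (insert w R) (by simpa using le_antisymm h1 (hnonneg _))
    rw [Finset.card_insert_of_notMem hw] at h2
    omega

theorem isGreatest_sqrt {y : ℝ} (hy : 0 < y) (h0 : matchingSum G y⁻¹ Finset.univ = 0)
    (h : ∀ t, y < t → matchingSum G t⁻¹ Finset.univ ≠ 0) :
    IsGreatest {x : ℝ | (matchingPoly G).IsRoot x} (√y) := by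
  constructor
  · rw [Set.mem_ofPred_eq, isRoot_matchingPoly_iff (Real.sqrt_pos.2 hy).ne', Real.sq_sqrt hy.le]
    exact h0
  · intro x hx
    by_contra hlt
    rw [not_le] at hlt
    have hx0 : 0 < x := (Real.sqrt_nonneg y).trans_lt hlt
    rw [Set.mem_ofPred_eq, isRoot_matchingPoly_iff hx0.ne'] at hx
    exact h _ ((Real.sqrt_lt' hx0).1 hlt) hx

theorem maxMatchingRoot_eq_sqrt {y : ℝ} (hy : 0 < y) (h0 : matchingSum G y⁻¹ Finset.univ = 0)
    (h : ∀ t, y < t → matchingSum G t⁻¹ Finset.univ ≠ 0) : maxMatchingRoot G = √y :=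
  (isGreatest_sqrt hy h0 h).csSup_eq

theorem exists_greatest_zero {u v : V} (huv : G.Adj u v) : ∃ y : ℝ, 0 < y ∧
    matchingSum G y⁻¹ Finset.univ = 0 ∧ ∀ t, y < t → matchingSum G t⁻¹ Finset.univ ≠ 0 := by
  obtain ⟨z, hz, h0, h⟩ := exists_least_zero huv
  exact ⟨z⁻¹, inv_pos.2 hz, by rwa [inv_inv], fun t ht =>
    h _ (inv_pos.2 ((inv_pos.2 hz).trans ht)) ((inv_lt_comm₀ hz ((inv_pos.2 hz).trans ht)).1 ht)⟩

theorem isGreatest_maxMatchingRoot {u v : V} (huv : G.Adj u v) :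
    IsGreatest {x : ℝ | (matchingPoly G).IsRoot x} (maxMatchingRoot G) := by
  obtain ⟨y, hy, h0, h⟩ := exists_greatest_zero huv
  rw [maxMatchingRoot_eq_sqrt hy h0 h]
  exact isGreatest_sqrt hy h0 h

/-- If no `t > Y` is a zero, then `√Y` bounds the largest matching root, and equality means that
`Y` is a zero. -/
theorem maxMatchingRoot_le_sqrt {u v : V} (huv : G.Adj u v) {Y : ℝ} (hY : 0 < Y)
    (h : ∀ t, Y < t → matchingSum G t⁻¹ Finset.univ ≠ 0) :
    maxMatchingRoot G ≤ √Y ∧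
      (maxMatchingRoot G = √Y ↔ matchingSum G Y⁻¹ Finset.univ = 0) := by
  obtain ⟨y, hy, h0, h'⟩ := exists_greatest_zero huv
  have hyY : y ≤ Y := not_lt.1 fun hlt => h y hlt h0
  rw [maxMatchingRoot_eq_sqrt hy h0 h']
  refine ⟨Real.sqrt_le_sqrt hyY, fun he => ?_, fun h1 => ?_⟩
  · rw [Real.sqrt_inj hy.le hY.le] at he
    rwa [← he]
  · rcases hyY.lt_or_eq with hlt | rfl
    · exact absurd h1 (h' Y hlt)
    · rfl

end Roots

/-! ### Windmills: classification, absence of even cycles, critical value. -/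

section Windmills

open scoped Classical

variable {V W : Type*} {G : SimpleGraph V} {H : SimpleGraph W}

/-- All edges of `G` lie in the closed neighbourhood of `c`, and the neighbours of `c` span a
matching: `G` consists of triangles and pendant edges at `c`, and isolated vertices. -/
structure IsWindmill (G : SimpleGraph V) (c : V) : Prop where
  adj_center : ∀ a b, G.Adj a b → a ≠ c → G.Adj c a
  unique : ∀ u w w', u ≠ c → w ≠ c → w' ≠ c → G.Adj u w → G.Adj u w' → w = w'

/-- After transport to one type, involutions moving equally many points have the same cycle type,
all 2s, and are conjugate. -/
theorem exists_equiv_of_involutive {α β : Type*} [Fintype α] [Fintype β] {f : α → α} {g : β → β}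
    (hf : Function.Involutive f) (hg : Function.Involutive g)
    (hc : Fintype.card α = Fintype.card β)
    (hfg : (Finset.univ.filter fun x => f x ≠ x).card =
      (Finset.univ.filter fun x => g x ≠ x).card) :
    ∃ e : α ≃ β, ∀ x, e (f x) = g (e x) := by
  obtain ⟨e₀⟩ := Fintype.card_eq.1 hc
  have hg' : Function.Involutive fun x => e₀.symm (g (e₀ x)) := fun x => by
    simp [hg (e₀ x)]
  have hcyc : ∀ {h : α → α} (hh : Function.Involutive h), 2 * hh.toPerm.cycleType.card =
      (Finset.univ.filter fun x => h x ≠ x).card ∧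
      hh.toPerm.cycleType = Multiset.replicate hh.toPerm.cycleType.card 2 := by
    intro h hh
    have h2 : hh.toPerm ^ 2 = 1 := by
      ext x
      simp [pow_two, hh x]
    have : Fact (Nat.Prime 2) := ⟨Nat.prime_two⟩
    have h3 := Equiv.Perm.cycleType_of_pow_prime_eq_one h2
    refine ⟨?_, h3⟩
    have h4 := hh.toPerm.sum_cycleType
    rw [h3, Multiset.sum_replicate, smul_eq_mul] at h4
    rw [mul_comm, h4]
    congr 1
  obtain ⟨f1, f2⟩ := hcyc hf
  obtain ⟨g1, g2⟩ := hcyc hg'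
  have hcard : (Finset.univ.filter fun x => e₀.symm (g (e₀ x)) ≠ x).card =
      (Finset.univ.filter fun x => g x ≠ x).card := by
    refine Finset.card_equiv e₀ fun x => ?_
    simp [Equiv.symm_apply_eq]
  have hconj : IsConj hf.toPerm hg'.toPerm := by
    rw [Equiv.Perm.isConj_iff_cycleType_eq, f2, g2]
    congr 1
    omega
  obtain ⟨k, hk⟩ := isConj_iff.1 hconj
  refine ⟨k.trans e₀, fun x => ?_⟩
  have := congrArg (fun p : Equiv.Perm α => p x) (mul_inv_eq_iff_eq_mul.1 hk)
  simp only [Equiv.Perm.mul_apply, Function.Involutive.coe_toPerm] at this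
  simp [this]

/-- The map exchanging the two outer vertices of each triangle of a windmill. -/
noncomputable def partner (G : SimpleGraph V) (c : V) (u : {u // G.Adj c u}) : {u // G.Adj c u} :=
  if h : ∃ w : {u // G.Adj c u}, G.Adj u w then h.choose else u

theorem IsWindmill.adj_iff_partner {c : V} (h : IsWindmill G c) (u w : {u // G.Adj c u}) :
    G.Adj u w ↔ u ≠ w ∧ partner G c u = w := by
  constructor
  · intro huw
    refine ⟨fun e => huw.ne (congrArg Subtype.val e), ?_⟩
    have hex : ∃ w : {u // G.Adj c u}, G.Adj u w := ⟨w, huw⟩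
    rw [partner, dif_pos hex]
    exact Subtype.ext (h.unique u _ w u.2.ne' hex.choose.2.ne' w.2.ne' hex.choose_spec huw)
  · rintro ⟨hne, rfl⟩
    by_cases hex : ∃ w : {u // G.Adj c u}, G.Adj u w
    · rw [partner, dif_pos hex]
      exact hex.choose_spec
    · rw [partner, dif_neg hex] at hne
      exact absurd rfl hne

theorem IsWindmill.partner_ne_iff {c : V} (h : IsWindmill G c) (u : {u // G.Adj c u}) :
    partner G c u ≠ u ↔ ∃ w : {u // G.Adj c u}, G.Adj u w := by
  constructor
  · intro hne
    exact ⟨_, (h.adj_iff_partner u _).2 ⟨hne.symm, rfl⟩⟩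
  · rintro ⟨w, hw⟩ he
    obtain ⟨h1, h2⟩ := (h.adj_iff_partner u w).1 hw
    exact h1 (he.symm.trans h2)

theorem IsWindmill.partner_involutive {c : V} (h : IsWindmill G c) :
    Function.Involutive (partner G c) := by
  intro u
  by_cases hu : partner G c u = u
  · rw [hu, hu]
  · have h1 := (h.adj_iff_partner u _).2 ⟨Ne.symm hu, rfl⟩
    exact ((h.adj_iff_partner _ u).1 h1.symm).2

/-- The vertices of a windmill that lie in a triangle, apart from the centre. -/
noncomputable def bladeSet [Fintype V] (G : SimpleGraph V) (c : V) : Finset V :=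
  Finset.univ.filter fun u => G.Adj c u ∧ ∃ w, G.Adj c w ∧ G.Adj u w

theorem IsWindmill.card_partner_ne [Fintype V] {c : V} (h : IsWindmill G c) :
    (Finset.univ.filter fun u => partner G c u ≠ u).card = (bladeSet G c).card := by
  rw [← Finset.card_map (Function.Embedding.subtype _)]
  congr 1
  ext u
  simp only [h.partner_ne_iff, Finset.mem_map, Finset.mem_filter, Finset.mem_univ, true_and,
    Function.Embedding.coe_subtype, bladeSet]
  constructor
  · rintro ⟨x, ⟨w, hw⟩, rfl⟩
    exact ⟨x.2, w, w.2, hw⟩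
  · rintro ⟨hu, w, hw, huw⟩
    exact ⟨⟨u, hu⟩, ⟨⟨w, hw⟩, huw⟩, rfl⟩

theorem ncard_neighborSet [Fintype V] (c : V) :
    (G.neighborSet c).ncard = (Finset.univ.filter (G.Adj c)).card := by
  rw [← Set.ncard_coe_finset]
  congr 1
  ext
  simp

/-- Degree sum: a vertex other than `c` has degree 1 for being adjacent to `c`, plus 1 for lying in
a triangle. -/
theorem IsWindmill.card_bladeSet [Fintype V] {c : V} (h : IsWindmill G c) :
    (bladeSet G c).card + 2 * (G.neighborSet c).ncard = 2 * size G := by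
  have h1 : ∀ a, a ≠ c → (Finset.univ.filter (G.Adj a)).card =
      (if G.Adj c a then 1 else 0) + if a ∈ bladeSet G c then 1 else 0 := by
    intro a ha
    by_cases hca : G.Adj c a
    · rw [if_pos hca]
      by_cases hb : a ∈ bladeSet G c
      · rw [if_pos hb]
        obtain ⟨-, w, hcw, haw⟩ := (Finset.mem_filter.1 hb).2
        have : Finset.univ.filter (G.Adj a) = {c, w} := by
          ext x
          simp only [Finset.mem_filter, Finset.mem_univ, true_and, Finset.mem_insert,
            Finset.mem_singleton]
          constructor
          · intro hx
            by_cases hxc : x = c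
            · exact Or.inl hxc
            · exact Or.inr (h.unique a x w ha hxc hcw.ne' hx haw)
          · rintro (rfl | rfl)
            · exact hca.symm
            · exact haw
        rw [this, Finset.card_pair hcw.ne]
      · rw [if_neg hb]
        have : Finset.univ.filter (G.Adj a) = {c} := by
          ext x
          simp only [Finset.mem_filter, Finset.mem_univ, true_and, Finset.mem_singleton]
          constructor
          · intro hx
            by_contra hxc
            exact hb (Finset.mem_filter.2 ⟨Finset.mem_univ _, hca, x,
              h.adj_center x a hx.symm hxc, hx⟩)
          · rintro rfl
            exact hca.symm
        rw [this, Finset.card_singleton]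
    · have hb : a ∉ bladeSet G c := fun hb => hca (Finset.mem_filter.1 hb).2.1
      rw [if_neg hca, if_neg hb, Finset.card_eq_zero, Finset.filter_eq_empty_iff]
      exact fun x _ hx => hca (h.adj_center a x hx ha)
  rw [← degSum_univ, degSum, ← Finset.add_sum_erase _ _ (Finset.mem_univ c),
    Finset.sum_congr rfl fun a ha => h1 a (Finset.ne_of_mem_erase ha), Finset.sum_add_distrib,
    ← Finset.card_filter, ← Finset.card_filter, ncard_neighborSet]
  have e1 : (Finset.univ.erase c).filter (G.Adj c) = Finset.univ.filter (G.Adj c) := by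
    ext x
    simp only [Finset.mem_filter, Finset.mem_erase, Finset.mem_univ, and_true, true_and]
    exact ⟨And.right, fun hx => ⟨hx.ne', hx⟩⟩
  have e2 : (Finset.univ.erase c).filter (· ∈ bladeSet G c) = bladeSet G c := by
    ext x
    simp only [Finset.mem_filter, Finset.mem_erase, Finset.mem_univ, and_true]
    exact ⟨And.right, fun hx => ⟨(Finset.mem_filter.1 hx).2.1.ne', hx⟩⟩
  rw [e1, e2]
  ring

/-- A windmill is determined up to isomorphism by its order, its size and the degree of its
centre. -/
theorem IsWindmill.nonempty_iso [Fintype V] [Fintype W] {c : V} {c' : W} (hG : IsWindmill G c)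
    (hH : IsWindmill H c') (hcard : Fintype.card V = Fintype.card W)
    (hdeg : (G.neighborSet c).ncard = (H.neighborSet c').ncard) (hsize : size G = size H) :
    Nonempty (G ≃g H) := by
  have hd : Fintype.card {u // G.Adj c u} = Fintype.card {u // H.Adj c' u} := by
    rwa [Fintype.card_subtype, Fintype.card_subtype, ← ncard_neighborSet, ← ncard_neighborSet]
  have hb : (bladeSet G c).card = (bladeSet H c').card := by
    have := hG.card_bladeSet
    have := hH.card_bladeSet
    omega
  obtain ⟨e, he⟩ := exists_equiv_of_involutive hG.partner_involutive hH.partner_involutive hd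
    (by
      have h1 := hG.card_partner_ne
      rw [hb, ← hH.card_partner_ne] at h1
      convert h1)
  have hd' : Fintype.card {u // ¬ G.Adj c u} = Fintype.card {u // ¬ H.Adj c' u} := by
    rw [Fintype.card_subtype_compl, Fintype.card_subtype_compl, hd, hcard]
  obtain ⟨g₀⟩ := Fintype.card_eq.1 hd'
  -- The centre is among its own non-neighbours; the swap makes the bijection of non-neighbours send
  -- centre to centre.
  set g := g₀.trans (Equiv.swap (g₀ ⟨c, G.loopless.irrefl c⟩) ⟨c', H.loopless.irrefl c'⟩) with hg
  have hgc : g ⟨c, G.loopless.irrefl c⟩ = ⟨c', H.loopless.irrefl c'⟩ := by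
    simp [hg]
  set f : V ≃ W := (Equiv.sumCompl (G.Adj c)).symm.trans
    ((e.sumCongr g).trans (Equiv.sumCompl (H.Adj c'))) with hf
  have f1 : ∀ u (hu : G.Adj c u), f u = e ⟨u, hu⟩ := by
    intro u hu
    simp [hf, Equiv.sumCompl_symm_apply_of_pos hu]
  have f2 : ∀ u (hu : ¬ G.Adj c u), f u = g ⟨u, hu⟩ := by
    intro u hu
    simp [hf, Equiv.sumCompl_symm_apply_of_neg hu]
  have fc : f c = c' := by
    rw [f2 c (G.loopless.irrefl c), hgc]
  have fadj : ∀ u, H.Adj c' (f u) ↔ G.Adj c u := by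
    intro u
    by_cases hu : G.Adj c u
    · rw [f1 u hu]
      exact iff_of_true (e ⟨u, hu⟩).2 hu
    · rw [f2 u hu]
      exact iff_of_false (g ⟨u, hu⟩).2 hu
  refine ⟨⟨f, ?_⟩⟩
  intro a b
  by_cases ha : a = c
  · subst ha
    rw [fc, fadj]
  by_cases hb : b = c
  · subst hb
    rw [fc, H.adj_comm, G.adj_comm, fadj]
  have hfa : f a ≠ c' := fun h => ha (f.injective (h.trans fc.symm))
  have hfb : f b ≠ c' := fun h => hb (f.injective (h.trans fc.symm))
  by_cases hca : G.Adj c a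
  · by_cases hcb : G.Adj c b
    · have h1 := hG.adj_iff_partner ⟨a, hca⟩ ⟨b, hcb⟩
      have h2 := hH.adj_iff_partner (e ⟨a, hca⟩) (e ⟨b, hcb⟩)
      rw [← he, e.apply_eq_iff_eq, e.injective.ne_iff] at h2
      rw [f1 a hca, f1 b hcb, h2]
      exact h1.symm
    · exact iff_of_false (fun h => hcb ((fadj b).1 (hH.adj_center _ _ h.symm hfb)))
        fun h => hcb (hG.adj_center _ _ h.symm hb)
  · exact iff_of_false (fun h => hca ((fadj a).1 (hH.adj_center _ _ h hfa)))
      fun h => hca (hG.adj_center _ _ h ha)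

theorem IsWindmill.of_iso {c : W} (hH : IsWindmill H c) (e : G ≃g H) :
    IsWindmill G (e.symm c) := by
  have key : ∀ a, a ≠ e.symm c → e a ≠ c := fun a ha h => ha (by rw [← h, e.symm_apply_apply])
  constructor
  · intro a b hab ha
    have := hH.adj_center _ _ (e.map_adj_iff.2 hab) (key a ha)
    rwa [← e.map_adj_iff, e.apply_symm_apply]
  · intro u w w' hu hw hw' h h'
    exact e.injective (hH.unique _ _ _ (key u hu) (key w hw) (key w' hw')
      (e.map_adj_iff.2 h) (e.map_adj_iff.2 h'))

theorem ncard_neighborSet_symm (e : G ≃g H) (c : W) :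
    (G.neighborSet (e.symm c)).ncard = (H.neighborSet c).ncard := by
  rw [← Set.ncard_image_of_injective _ e.injective]
  congr 1
  ext x
  simp only [Set.mem_image, SimpleGraph.mem_neighborSet]
  constructor
  · rintro ⟨a, ha, rfl⟩
    rw [← e.map_adj_iff, e.apply_symm_apply] at ha
    exact ha
  · intro hx
    refine ⟨e.symm x, ?_, e.apply_symm_apply x⟩
    rwa [← e.map_adj_iff, e.apply_symm_apply, e.apply_symm_apply]

theorem IsWindmill.sum_bot {c : V} (h : IsWindmill G c) :
    IsWindmill (G ⊕g (⊥ : SimpleGraph W)) (Sum.inl c) := by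
  constructor
  · rintro (a | a) (b | b) hab ha
    · exact h.adj_center a b hab fun e => ha (congrArg _ e)
    all_goals simp at hab
  · rintro (u | u) (w | w) (w' | w') hu hw hw' h1 h2
    · rw [h.unique u w w' (fun e => hu (congrArg _ e)) (fun e => hw (congrArg _ e))
        (fun e => hw' (congrArg _ e)) h1 h2]
    all_goals simp at h1 h2

theorem ncard_neighborSet_sum_bot (c : V) :
    ((G ⊕g (⊥ : SimpleGraph W)).neighborSet (Sum.inl c)).ncard = (G.neighborSet c).ncard := by
  rw [← Set.ncard_image_of_injective (G.neighborSet c) (Sum.inl_injective (β := W))]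
  congr 1
  ext (x | x) <;> simp

theorem size_sum_bot [Finite V] : size (G ⊕g (⊥ : SimpleGraph W)) = size G := by
  rw [size, size, ← Nat.card_coe_set_eq, ← Nat.card_coe_set_eq,
    Nat.card_congr SimpleGraph.edgeSetSumEquiv]
  have : IsEmpty (⊥ : SimpleGraph W).edgeSet := by simp
  have : Finite G.edgeSet := Set.toFinite _
  rw [Nat.card_sum]
  simp

/-- A windmill with a given order, size and centre degree, up to isomorphism. -/
theorem nonempty_iso_sum_bot_iff [Fintype V] [Fintype W] {U : Type*} [Fintype U] {c : W}
    (hH : IsWindmill H c) (hsize : size G = size H)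
    (hcard : Fintype.card V = Fintype.card W + Fintype.card U) :
    Nonempty (G ≃g (H ⊕g (⊥ : SimpleGraph U))) ↔
      ∃ v, IsWindmill G v ∧ (G.neighborSet v).ncard = (H.neighborSet c).ncard := by
  constructor
  · rintro ⟨e⟩
    refine ⟨_, hH.sum_bot.of_iso e, ?_⟩
    rw [ncard_neighborSet_symm, ncard_neighborSet_sum_bot]
  · rintro ⟨v, hv, hdeg⟩
    exact hv.nonempty_iso hH.sum_bot (by rw [hcard, Fintype.card_sum])
      (by rw [hdeg, ncard_neighborSet_sum_bot]) (by rw [hsize, size_sum_bot])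

theorem nonempty_iso_iff [Fintype V] [Fintype W] {c : W} (hH : IsWindmill H c)
    (hsize : size G = size H) (hcard : Fintype.card V = Fintype.card W) :
    Nonempty (G ≃g H) ↔
      ∃ v, IsWindmill G v ∧ (G.neighborSet v).ncard = (H.neighborSet c).ncard := by
  constructor
  · rintro ⟨e⟩
    exact ⟨_, hH.of_iso e, ncard_neighborSet_symm e c⟩
  · rintro ⟨v, hv, hdeg⟩
    exact hv.nonempty_iso hH hcard hdeg hsize

/-- Off `c` the edges form a matching, so every cycle passes through `c` and returns to it after
three steps. -/
theorem IsWindmill.isOddCycleGraph {c : V} (h : IsWindmill G c) : IsOddCycleGraph G := by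
  have hmem : ∀ (v : V) (p : G.Walk v v), p.IsCycle → c ∈ p.support := by
    intro v p hp
    by_contra hc
    match p, hp, hc with
    | .nil, hp, _ => exact hp.ne_nil rfl
    | .cons h1 .nil, _, _ => exact G.loopless.irrefl _ h1
    | .cons (v := a) h1 (.cons (v := b) h2 q), hp, hc =>
      simp only [SimpleGraph.Walk.support_cons, List.mem_cons, not_or] at hc
      have hb : c ≠ b := by
        rintro rfl
        exact hc.2.2 q.start_mem_support
      obtain rfl := h.unique a v b (Ne.symm hc.2.1) (Ne.symm hc.1) hb.symm h1.symm h2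
      have := hp.isCircuit.isTrail.edges_nodup
      simp [Sym2.eq_swap] at this
  have hlen : ∀ p : G.Walk c c, p.IsCycle → p.length = 3 := by
    intro p hp
    match p, hp with
    | .nil, hp => exact absurd rfl hp.ne_nil
    | .cons h1 .nil, _ => exact absurd h1 (G.loopless.irrefl _)
    | .cons h1 (.cons h2 .nil), hp => exact absurd hp.three_le_length (by simp)
    | .cons (v := a) h1 (.cons (v := b) h2 (.cons (v := x) h3 q)), hp =>
      have hed := hp.isCircuit.isTrail.edges_nodup
      have hsup := hp.support_nodup
      have hbc : b ≠ c := by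
        rintro rfl
        simp [Sym2.eq_swap] at hed
      have hxc : x = c := by
        by_contra hxc
        obtain rfl := h.unique b a x hbc h1.ne' hxc h2.symm h3
        simp [Sym2.eq_swap] at hed
      subst hxc
      match q with
      | .nil => rfl
      | .cons h4 q =>
        simp only [SimpleGraph.Walk.support_cons, List.tail_cons, List.nodup_cons,
          List.mem_cons, not_or] at hsup
        exact absurd q.end_mem_support hsup.2.2.1
  intro v p hp
  have h1 := hlen _ (hp.rotate (hmem v p hp))
  rw [SimpleGraph.Walk.length_rotate] at h1
  rw [h1]
  decide

/-- The matching sum of a windmill vanishes at its critical value. -/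
theorem IsWindmill.matchingSum_eq_zero [Fintype V] {c : V} (h : IsWindmill G c) {y : ℝ}
    (hy : 1 < y) (hcrit : y = (G.neighborSet c).ncard +
      2 * ((size G : ℝ) - (G.neighborSet c).ncard) / (y - 1)) :
    matchingSum G y⁻¹ Finset.univ = 0 := by
  set R : Finset V := Finset.univ.erase c with hR
  have hy0 : 0 < y := by linarith
  have h1z : 1 - y⁻¹ ≠ 0 := by
    have : y⁻¹ < 1 := inv_lt_one_of_one_lt₀ hy
    linarith
  have hblade : ∀ u ∈ bladeSet G c,
      matchingSum G y⁻¹ (R.erase u) = (y / (y - 1)) * matchingSum G y⁻¹ R := by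
    intro u hu
    obtain ⟨hcu, w, hcw, huw⟩ := (Finset.mem_filter.1 hu).2
    have huR : u ∈ R := Finset.mem_erase.2 ⟨hcu.ne', Finset.mem_univ _⟩
    have hfil : R.filter (G.Adj u) = {w} := by
      ext x
      simp only [hR, Finset.mem_filter, Finset.mem_erase, Finset.mem_univ, and_true,
        Finset.mem_singleton]
      constructor
      · rintro ⟨hxc, hux⟩
        exact h.unique u x w hcu.ne' hxc hcw.ne' hux huw
      · rintro rfl
        exact ⟨hcw.ne', huw⟩
    -- Without `u`, the partner `w` is isolated in `R`, so M(R) = (1 - 1/y) M(R-u).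
    have hiso : matchingSum G y⁻¹ (R.erase u) = matchingSum G y⁻¹ ((R.erase u).erase w) := by
      refine matchingSum_eq_erase _ fun x hx hwx => ?_
      obtain ⟨hxu, hxR⟩ := Finset.mem_erase.1 hx
      exact hxu (h.unique w x u hcw.ne' (Finset.ne_of_mem_erase hxR) hcu.ne' hwx huw.symm)
    have := matchingSum_rec (G := G) y⁻¹ huR
    rw [hfil, Finset.sum_singleton, ← hiso] at this
    rw [this]
    have : y - 1 ≠ 0 := by linarith
    field_simp
  have hpend : ∀ u, G.Adj c u → u ∉ bladeSet G c →
      matchingSum G y⁻¹ (R.erase u) = matchingSum G y⁻¹ R := by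
    intro u hcu hu
    refine (matchingSum_eq_erase _ fun x hx hux => hu ?_).symm
    exact Finset.mem_filter.2 ⟨Finset.mem_univ _, hcu, x,
      h.adj_center x u hux.symm (Finset.ne_of_mem_erase hx), hux⟩
  have hsub : bladeSet G c ⊆ Finset.univ.filter (G.Adj c) := fun u hu =>
    Finset.mem_filter.2 ⟨Finset.mem_univ _, (Finset.mem_filter.1 hu).2.1⟩
  have hsum : ∑ u ∈ Finset.univ.filter (G.Adj c), matchingSum G y⁻¹ (R.erase u) =
      (((G.neighborSet c).ncard - (bladeSet G c).card : ℝ) +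
        (bladeSet G c).card * (y / (y - 1))) * matchingSum G y⁻¹ R := by
    rw [← Finset.sum_sdiff hsub, Finset.sum_congr rfl hblade,
      Finset.sum_congr rfl fun u hu => hpend u
        (Finset.mem_filter.1 (Finset.mem_sdiff.1 hu).1).2 (Finset.mem_sdiff.1 hu).2,
      Finset.sum_const, Finset.sum_const, nsmul_eq_mul, nsmul_eq_mul,
      Finset.card_sdiff_of_subset hsub, Nat.cast_sub (Finset.card_le_card hsub),
      ncard_neighborSet]
    ring
  have hb : ((bladeSet G c).card : ℝ) = 2 * ((size G : ℝ) - (G.neighborSet c).ncard) := by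
    have : ((bladeSet G c).card : ℝ) + 2 * (G.neighborSet c).ncard = 2 * size G := by
      exact_mod_cast h.card_bladeSet
    linarith
  rw [matchingSum_rec _ (Finset.mem_univ c), hsum]
  rw [← hb] at hcrit
  have hy1 : y - 1 ≠ 0 := by linarith
  have : ((G.neighborSet c).ncard - (bladeSet G c).card : ℝ) +
      (bladeSet G c).card * (y / (y - 1)) = y := by
    conv_rhs => rw [hcrit]
    field_simp
    ring
  rw [this, ← mul_assoc, inv_mul_cancel₀ hy0.ne', one_mul, sub_self]

end Windmills

/-! ### Extremal comparison at the critical value. -/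

section Extremal

open scoped Classical

variable {V : Type*} {G : SimpleGraph V}

theorem degSum_le_card_mul (B : Finset V) : degSum G B ≤ B.card * (B.card - 1) := by
  rw [degSum, ← smul_eq_mul, ← Finset.sum_const]
  refine Finset.sum_le_sum fun a ha => ?_
  rw [← Finset.card_erase_of_mem ha]
  refine Finset.card_le_card fun x hx => ?_
  obtain ⟨h1, h2⟩ := Finset.mem_filter.1 hx
  exact Finset.mem_erase.2 ⟨h2.ne', h1⟩

/-- A connected set with at most two edges induces a tree. -/
theorem ConnOn.degSum_add_two {B : Finset V} (hB : ConnOn G B) (h : degSum G B ≤ 4) :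
    degSum G B + 2 = 2 * B.card := by
  have h1 := hB.two_mul_card_le
  have h2 := degSum_le_card_mul (G := G) B
  have h3 := Finset.card_pos.2 hB.1
  have h4 : B.card ≤ 3 := by omega
  interval_cases B.card <;> omega

theorem weight_eq_mul (d : ℝ) (B : Finset V) :
    weight G d B = B.card * (1 - d) + d * ((degSum G B : ℝ) / 2 + 1) := by
  rw [weight]
  ring

variable [Fintype V]

theorem mem_of_degSum_eq {B : Finset V} (h : degSum G B = 2 * size G) {a b : V}
    (hab : G.Adj a b) : a ∈ B := by
  by_contra ha
  rw [← degSum_univ] at h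
  have h1 : ∑ x ∈ insert a B, (Finset.univ.filter (G.Adj x)).card ≤ degSum G Finset.univ :=
    Finset.sum_le_sum_of_subset (Finset.subset_univ _)
  rw [Finset.sum_insert ha] at h1
  have h2 : degSum G B ≤ ∑ x ∈ B, (Finset.univ.filter (G.Adj x)).card :=
    Finset.sum_le_sum fun _ _ => Finset.card_le_card
      (Finset.filter_subset_filter _ (Finset.subset_univ _))
  have h3 : 0 < (Finset.univ.filter (G.Adj a)).card := Finset.card_pos.2 ⟨b, by simpa using hab⟩
  omega

/-- `B` carries all edges, and two neighbours of `u` other than `c` would close a four-cycle through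
`c` and `u`. -/
theorem IsOddCycleGraph.isWindmill (hG : IsOddCycleGraph G) {B : Finset V} {c : V} (hc : c ∈ B)
    (hdom : ∀ w ∈ B, w ≠ c → G.Adj c w) (hB : degSum G B = 2 * size G) :
    IsWindmill G c ∧ (G.neighborSet c).ncard + 1 = B.card := by
  refine ⟨⟨fun a b hab ha => hdom a (mem_of_degSum_eq hB hab) ha, ?_⟩, ?_⟩
  · intro u w w' hu hw hw' h h'
    by_contra hne
    exact hG.no_four_cycle (hdom w (mem_of_degSum_eq hB h.symm) hw)
      (hdom w' (mem_of_degSum_eq hB h'.symm) hw') h.symm h' hne hu.symm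
  · have : Finset.univ.filter (G.Adj c) = B.erase c := by
      ext x
      simp only [Finset.mem_filter, Finset.mem_univ, true_and, Finset.mem_erase]
      exact ⟨fun hx => ⟨hx.ne', mem_of_degSum_eq hB hx.symm⟩, fun hx => hdom x hx.2 hx.1⟩
    rw [ncard_neighborSet, this, Finset.card_erase_add_one hc]

theorem IsF.exists_isWindmill {k m : ℕ} (h : IsF k m G) :
    ∃ c, IsWindmill G c ∧ (G.neighborSet c).ncard = k - 1 := by
  obtain ⟨c, hc⟩ := h.exists_degree
  have hk := h.order_eq
  rw [Nat.card_eq_fintype_card] at hk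
  refine ⟨c, (h.oddCycle.isWindmill (Finset.mem_univ c) ?_ degSum_univ).1, hc⟩
  have h1 : Finset.univ.filter (G.Adj c) = Finset.univ.erase c := by
    refine Finset.eq_of_subset_of_card_le (fun x hx => ?_) ?_
    · exact Finset.mem_erase.2 ⟨(Finset.mem_filter.1 hx).2.ne', Finset.mem_univ _⟩
    · rw [← ncard_neighborSet, hc, Finset.card_erase_of_mem (Finset.mem_univ _), Finset.card_univ, hk]
  intro w _ hw
  have : w ∈ Finset.univ.filter (G.Adj c) := h1 ▸ Finset.mem_erase.2 ⟨hw, Finset.mem_univ _⟩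
  exact (Finset.mem_filter.1 this).2

theorem IsOddCycleGraph.matchingSum_ne_zero (hG : IsOddCycleGraph G) {t : ℝ} (ht : 1 < t)
    (h : ∀ B, ConnOn G B → weight G (2 / (t - 1)) B < t + 1) :
    matchingSum G t⁻¹ Finset.univ ≠ 0 := by
  intro h0
  obtain ⟨B, hB, hB0⟩ := exists_connOn_of_matchingSum_eq_zero h0
  exact ((hG.rootBound ht (div_mul_cancel₀ 2 (by linarith)) _ B rfl hB (h B hB).le).pos hB.1
    (by linarith) (h B hB)).ne' hB0

/-- If all connected sets have at most critical weight at `y`, then `√y` bounds the largest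
matching root, and only windmills attain the bound. -/
theorem IsOddCycleGraph.maxMatchingRoot_le (hG : IsOddCycleGraph G) (hpos : 1 ≤ size G) {y : ℝ}
    (hy : 1 < y) (h1 : ∀ t, y ≤ t → ∀ B, ConnOn G B → weight G (2 / (t - 1)) B ≤ y + 1)
    (h2 : ∀ B, ConnOn G B → weight G (2 / (y - 1)) B = y + 1 → degSum G B = 2 * size G) :
    maxMatchingRoot G ≤ √y ∧ (maxMatchingRoot G = √y ↔ ∃ c, IsWindmill G c ∧
      y = (G.neighborSet c).ncard + 2 * ((size G : ℝ) - (G.neighborSet c).ncard) / (y - 1)) := by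
  obtain ⟨e, he⟩ := (Set.ncard_pos (Set.toFinite _)).1 (show 0 < G.edgeSet.ncard from hpos)
  induction e with
  | _ u v =>
  have huv : G.Adj u v := he
  obtain ⟨h3, h4⟩ := maxMatchingRoot_le_sqrt huv (by linarith : 0 < y) fun t ht =>
    hG.matchingSum_ne_zero (hy.trans ht) fun B hB => (h1 t ht.le B hB).trans_lt (by linarith)
  refine ⟨h3, h4.trans ⟨fun h0 => ?_, ?_⟩⟩
  · obtain ⟨B, hB, hB0⟩ := exists_connOn_of_matchingSum_eq_zero h0
    have hd : 2 / (y - 1) * (y - 1) = 2 := div_mul_cancel₀ 2 (by linarith)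
    have hw : weight G (2 / (y - 1)) B = y + 1 := by
      refine (h1 y le_rfl B hB).lt_or_eq.resolve_left fun hlt => ?_
      exact ((hG.rootBound hy hd _ B rfl hB hlt.le).pos hB.1 (by linarith) hlt).ne' hB0
    obtain ⟨c, hc, hdom⟩ := hG.exists_dominating hy hd hB hw hB0
    have hdeg := h2 B hB hw
    obtain ⟨hwind, hcard⟩ := hG.isWindmill hc hdom hdeg
    refine ⟨c, hwind, ?_⟩
    rw [weight, hdeg, ← hcard] at hw
    push_cast at hw
    rw [mul_div_right_comm]
    linarith
  · rintro ⟨c, hc, hcrit⟩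
    exact hc.matchingSum_eq_zero hy hcrit

theorem degSum_le (B : Finset V) : degSum G B ≤ 2 * size G :=
  degSum_univ (G := G) ▸ degSum_mono (Finset.subset_univ B)

theorem ConnOn.weight_eq_card {B : Finset V} (hB : ConnOn G B) (h : size G ≤ 2) (d : ℝ) :
    weight G d B = B.card := by
  have h1 := hB.degSum_add_two ((degSum_le B).trans (by omega))
  have h2 : (degSum G B : ℝ) + 2 = 2 * B.card := by exact_mod_cast h1
  rw [weight, show (degSum G B : ℝ) / 2 - B.card + 1 = 0 by linarith, mul_zero, add_zero]

theorem ConnOn.card_le_size {B : Finset V} (hB : ConnOn G B) : B.card ≤ size G + 1 := by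
  have := hB.two_mul_card_le
  have := degSum_le (G := G) B
  omega

/-- At y = 1 the coefficient 2/(y-1) degenerates, so the zero is exhibited directly; only t > 1 is
excluded by weights. -/
theorem IsOddCycleGraph.maxMatchingRoot_eq_one (hG : IsOddCycleGraph G) (h : size G = 1) :
    maxMatchingRoot G = 1 := by
  obtain ⟨e, he⟩ := Set.ncard_eq_one.1 h
  induction e with
  | _ u v =>
  have huv : G.Adj u v := by
    rw [← SimpleGraph.mem_edgeSet, he]
    rfl
  rw [← Real.sqrt_one]
  refine maxMatchingRoot_eq_sqrt one_pos ?_ fun t ht => hG.matchingSum_ne_zero ht fun B hB => ?_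
  · rw [← Finset.union_compl {u, v}, matchingSum_union _ disjoint_compl_right, matchingSum_pair _ huv]
    · norm_num
    · intro a ha b hb hab
      have : s(a, b) ∈ G.edgeSet := hab
      rw [he, Set.mem_singleton_iff, Sym2.eq_iff] at this
      simp only [Finset.mem_compl, Finset.mem_insert, Finset.mem_singleton, not_or] at hb
      rcases this with ⟨-, h⟩ | ⟨-, h⟩
      · exact hb.2 h
      · exact hb.1 h
  · have h1 : (B.card : ℝ) ≤ 2 := by
      have := hB.card_le_size
      exact_mod_cast (by omega : B.card ≤ 2)
    rw [hB.weight_eq_card (by omega)]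
    linarith

theorem IsOddCycleGraph.maxMatchingRoot_le_sqrt_two (hG : IsOddCycleGraph G) (h : size G = 2) :
    maxMatchingRoot G ≤ √2 ∧ (maxMatchingRoot G = √2 ↔
      ∃ c, IsWindmill G c ∧ (G.neighborSet c).ncard = 2) := by
  have hcard : ∀ B, ConnOn G B → B.card ≤ 3 := fun B hB => by
    have := hB.card_le_size
    omega
  obtain ⟨h1, h2⟩ := hG.maxMatchingRoot_le (y := 2) (by omega) (by norm_num)
    (fun t _ B hB => by
      rw [hB.weight_eq_card h.le]
      have : (B.card : ℝ) ≤ 3 := by exact_mod_cast hcard B hB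
      linarith)
    (fun B hB hw => by
      rw [hB.weight_eq_card h.le] at hw
      have h3 : B.card = 3 := by
        have : (B.card : ℝ) = 3 := by linarith
        exact_mod_cast this
      have := hB.degSum_add_two ((degSum_le B).trans (by omega))
      omega)
  refine ⟨h1, h2.trans (exists_congr fun c => and_congr_right fun _ => ?_)⟩
  rw [h]
  constructor
  · intro hc
    have : ((G.neighborSet c).ncard : ℝ) = 2 := by
      norm_num at hc
      linarith
    exact_mod_cast this
  · intro hc
    rw [hc]
    norm_num

/-- Comparison of the largest matching root with the critical value for order `N`. -/
theorem IsOddCycleGraph.maxMatchingRoot_le_of_card_le (hG : IsOddCycleGraph G)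
    (hpos : 1 ≤ size G) {N : ℕ} (hN : N ≤ size G + 1) (hcard : ∀ B, ConnOn G B → B.card ≤ N)
    {y : ℝ} (hy : 3 ≤ y) (hcrit : y = (N - 1 : ℝ) + 2 * ((size G : ℝ) - (N - 1)) / (y - 1)) :
    maxMatchingRoot G ≤ √y ∧ (maxMatchingRoot G = √y ↔ ∃ c, IsWindmill G c ∧
      y = (G.neighborSet c).ncard + 2 * ((size G : ℝ) - (G.neighborSet c).ncard) / (y - 1)) := by
  have hd0 : 0 < 2 / (y - 1) := div_pos two_pos (by linarith)
  have hN' : (N : ℝ) ≤ size G + 1 := by exact_mod_cast hN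
  have hdeg : ∀ B, (degSum G B : ℝ) ≤ 2 * size G := fun B => by exact_mod_cast degSum_le B
  rw [mul_div_right_comm] at hcrit
  -- This is where `3 ≤ y` enters: the weight is then nondecreasing in the order of the set.
  have hdy : 2 / (y - 1) ≤ 1 := (div_le_one (by linarith)).2 (by linarith)
  refine hG.maxMatchingRoot_le hpos (by linarith) (fun t ht B hB => ?_) fun B hB hw => ?_
  · have hc : (B.card : ℝ) ≤ N := by exact_mod_cast hcard B hB
    have hdt : 2 / (t - 1) ≤ 2 / (y - 1) :=
      div_le_div_of_nonneg_left two_pos.le (by linarith) (by linarith)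
    have hdt0 : 0 ≤ 2 / (t - 1) := div_nonneg two_pos.le (by linarith)
    rw [weight_eq_mul]
    have a1 : (B.card : ℝ) * (1 - 2 / (t - 1)) ≤ N * (1 - 2 / (t - 1)) :=
      mul_le_mul_of_nonneg_right hc (by linarith)
    have a2 : 2 / (t - 1) * ((degSum G B : ℝ) / 2 + 1) ≤ 2 / (t - 1) * (size G + 1) :=
      mul_le_mul_of_nonneg_left (by linarith [hdeg B]) hdt0
    have a3 : 2 / (t - 1) * (size G + 1 - N : ℝ) ≤ 2 / (y - 1) * (size G + 1 - N) :=
      mul_le_mul_of_nonneg_right hdt (by linarith)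
    linarith
  · have hc : (B.card : ℝ) ≤ N := by exact_mod_cast hcard B hB
    rw [weight_eq_mul] at hw
    have a1 : (B.card : ℝ) * (1 - 2 / (y - 1)) ≤ N * (1 - 2 / (y - 1)) :=
      mul_le_mul_of_nonneg_right hc (by linarith)
    have a2 : 2 / (y - 1) * (2 * size G : ℝ) ≤ 2 / (y - 1) * (degSum G B : ℝ) := by linarith
    have a3 : (2 * size G : ℝ) ≤ degSum G B := le_of_mul_le_mul_left a2 hd0
    exact_mod_cast le_antisymm (hdeg B) a3

/-- At y = 3 the critical equation holds for every centre degree, and a windmill with three edges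
has centre degree 2 or 3. -/
theorem IsOddCycleGraph.maxMatchingRoot_le_sqrt_three (hG : IsOddCycleGraph G) (h : size G = 3) :
    maxMatchingRoot G ≤ √3 ∧ (maxMatchingRoot G = √3 ↔ ∃ c, IsWindmill G c ∧
      ((G.neighborSet c).ncard = 2 ∨ (G.neighborSet c).ncard = 3)) := by
  obtain ⟨h1, h2⟩ := hG.maxMatchingRoot_le_of_card_le (N := 4) (y := 3) (by omega) (by omega)
    (fun B hB => by
      have := hB.card_le_size
      omega) le_rfl (by rw [h]; norm_num)
  refine ⟨h1, h2.trans (exists_congr fun c => and_congr_right fun hc => ?_)⟩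
  have h3 := hc.card_bladeSet
  have h4 : (bladeSet G c).card ≤ (G.neighborSet c).ncard := by
    rw [ncard_neighborSet]
    exact Finset.card_le_card fun u hu =>
      Finset.mem_filter.2 ⟨Finset.mem_univ _, (Finset.mem_filter.1 hu).2.1⟩
  refine iff_of_true ?_ (by omega)
  rw [h]
  push_cast
  ring

/-- `y` is the larger root of (y-(N-1))(y-1) = 2(m-(N-1)), with discriminant `D`. Subtracting the
equations for `g` and N - 1 leaves (g-(N-1))(y-3) = 0, so y > 3 determines `g`. -/
theorem exists_critical {N m : ℕ} (hN : 4 ≤ N) (hm : 4 ≤ m) (hNm : N ≤ m + 1) :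
    ∃ y : ℝ, 3 < y ∧ ∀ g : ℕ, y = g + 2 * ((m : ℝ) - g) / (y - 1) ↔ g = N - 1 := by
  have hN' : (4 : ℝ) ≤ N := by exact_mod_cast hN
  have hm' : (4 : ℝ) ≤ m := by exact_mod_cast hm
  have hNm' : (N : ℝ) ≤ m + 1 := by exact_mod_cast hNm
  set D : ℝ := (N - 2) ^ 2 + 8 * (m - (N - 1)) with hD
  have hD0 : 0 ≤ D := by
    have := sq_nonneg ((N : ℝ) - 2)
    linarith
  have hs := Real.sq_sqrt hD0
  have hs0 := Real.sqrt_nonneg D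
  set s := √D
  set y : ℝ := (N + s) / 2 with hy
  have hquad : (y - (N - 1)) * (y - 1) = 2 * (m - (N - 1)) := by
    have : 4 * ((y - (N - 1)) * (y - 1)) = s ^ 2 - (N - 2) ^ 2 := by
      rw [hy]; ring
    rw [hs, hD] at this
    linarith
  have hsN : (N : ℝ) - 2 ≤ s := abs_le_of_sq_le_sq' (by rw [hs]; linarith) hs0 |>.2
  have hy3 : 3 < y := by
    rcases hN.lt_or_eq with h5 | h4
    · have : (5 : ℝ) ≤ N := by exact_mod_cast h5
      linarith
    · have h4' : (N : ℝ) = 4 := by exact_mod_cast h4.symm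
      have : 3 ≤ y := by linarith
      -- For N = 4 the value y = 3 would force m = 3.
      refine lt_of_le_of_ne this fun he => ?_
      rw [← he, h4'] at hquad
      linarith
  have hy1 : y - 1 ≠ 0 := by linarith
  refine ⟨y, hy3, fun g => ?_⟩
  have hiff : y = g + 2 * ((m : ℝ) - g) / (y - 1) ↔ (y - g) * (y - 1) = 2 * (m - g) := by
    rw [← sub_eq_iff_eq_add', eq_div_iff hy1]
  rw [hiff]
  constructor
  · intro h
    have h1 : ((g : ℝ) - (N - 1)) * (y - 3) = 0 := by linear_combination hquad - h
    have h2 : (g : ℝ) + 1 = N := by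
      rcases mul_eq_zero.1 h1 with h1 | h1 <;> linarith
    have h3 : g + 1 = N := by exact_mod_cast h2
    omega
  · rintro rfl
    rw [Nat.cast_sub (by omega), Nat.cast_one]
    exact hquad

/-- The main comparison: `F(N, m)` maximizes the largest matching root among the odd-cycle graphs
of size `m` whose connected sets have at most `N` vertices. -/
theorem IsOddCycleGraph.maxMatchingRoot_le_isF (hG : IsOddCycleGraph G) {N m : ℕ}
    (hsize : size G = m) (hN : 4 ≤ N) (hm : 4 ≤ m) (hNm : N ≤ m + 1)
    (hcard : ∀ B, ConnOn G B → B.card ≤ N) {F : SimpleGraph (Fin N)} (hF : IsF N m F) :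
    maxMatchingRoot G ≤ maxMatchingRoot F ∧ (maxMatchingRoot G = maxMatchingRoot F ↔
      ∃ c, IsWindmill G c ∧ (G.neighborSet c).ncard = N - 1) := by
  obtain ⟨y, hy3, hy⟩ := exists_critical hN hm hNm
  have hcrit : y = (N - 1 : ℝ) + 2 * ((m : ℝ) - (N - 1)) / (y - 1) := by
    have := (hy (N - 1)).2 rfl
    rwa [Nat.cast_sub (by omega), Nat.cast_one] at this
  have hFroot : maxMatchingRoot F = √y := by
    have := hF.size_eq
    refine ((hF.oddCycle.maxMatchingRoot_le_of_card_le (N := N) (by omega) (by omega)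
      (fun B _ => by simpa using Finset.card_le_univ B) hy3.le (by rw [this]; exact hcrit)).2).2 ?_
    obtain ⟨c, hc, hdeg⟩ := hF.exists_isWindmill
    exact ⟨c, hc, by rw [this]; exact (hy _).2 hdeg⟩
  obtain ⟨h1, h2⟩ := hG.maxMatchingRoot_le_of_card_le (by omega) (by omega) hcard hy3.le
    (by rw [hsize]; exact hcrit)
  rw [hFroot]
  refine ⟨h1, h2.trans (exists_congr fun c => and_congr_right fun _ => ?_)⟩
  rw [hsize]
  exact hy _

end Extremal

/-! ### Existence of F(k, m); stars and the triangle as windmills. -/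

section Existence

open scoped Classical

/-- The windmill on `Fin k` with centre `0` and triangles `{0, 2 j - 1, 2 j}` for `1 ≤ j ≤ a`. -/
def windmillGraph (k a : ℕ) : SimpleGraph (Fin k) where
  Adj i j := i ≠ j ∧ (i.1 = 0 ∨ j.1 = 0 ∨
    ((i.1 + 1) / 2 = (j.1 + 1) / 2 ∧ i.1 ≤ 2 * a ∧ j.1 ≤ 2 * a))
  symm := ⟨fun _ _ h => ⟨h.1.symm, by tauto⟩⟩
  loopless := ⟨fun _ h => h.1 rfl⟩

theorem windmillGraph_isWindmill {k : ℕ} (hk : 0 < k) (a : ℕ) :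
    IsWindmill (windmillGraph k a) ⟨0, hk⟩ := by
  constructor
  · intro i j _ hi
    exact ⟨hi.symm, Or.inl rfl⟩
  · intro u w w' hu hw hw' h h'
    simp only [windmillGraph, ne_eq, Fin.ext_iff] at hu hw hw' h h' ⊢
    omega

theorem isF_windmillGraph {k a : ℕ} (hk : 0 < k) (ha : 2 * a ≤ k - 1) :
    IsF k (k - 1 + a) (windmillGraph k a) := by
  have hw := windmillGraph_isWindmill hk a
  have hdeg : ((windmillGraph k a).neighborSet ⟨0, hk⟩).ncard = k - 1 := by
    have : Finset.univ.filter ((windmillGraph k a).Adj ⟨0, hk⟩) = Finset.univ.erase ⟨0, hk⟩ := by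
      ext i
      simp only [windmillGraph, Finset.mem_filter, Finset.mem_univ, true_and, Finset.mem_erase,
        and_true, true_or, ne_comm]
    rw [ncard_neighborSet, this, Finset.card_erase_of_mem (Finset.mem_univ _), Finset.card_univ,
      Fintype.card_fin]
  have hblade : (bladeSet (windmillGraph k a) ⟨0, hk⟩).card = 2 * a := by
    rw [← Finset.card_map Fin.valEmbedding]
    have : (bladeSet (windmillGraph k a) ⟨0, hk⟩).map Fin.valEmbedding = Finset.Icc 1 (2 * a) := by
      ext x
      simp only [Finset.mem_map, bladeSet, Finset.mem_filter, Finset.mem_univ, true_and,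
        windmillGraph, Fin.valEmbedding_apply, Finset.mem_Icc, ne_eq, Fin.ext_iff]
      constructor
      · rintro ⟨u, ⟨hu, w, hw, huw⟩, rfl⟩
        omega
      · rintro ⟨h1, h2⟩
        refine ⟨⟨x, by omega⟩, ⟨by simp; omega, ?_⟩, rfl⟩
        rcases Nat.even_or_odd x with hx | hx
        · rw [Nat.even_iff] at hx
          refine ⟨⟨x - 1, by omega⟩, by simp; omega, ?_⟩
          simp only
          omega
        · rw [Nat.odd_iff] at hx
          refine ⟨⟨x + 1, by omega⟩, by simp, ?_⟩
          simp only
          omega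
    rw [this]
    simp
  refine ⟨by simp, ?_, hw.isOddCycleGraph, ⟨0, hk⟩, hdeg⟩
  have := hw.card_bladeSet
  omega

theorem isF_existsUnique {k m : ℕ} (hk : 1 ≤ k) (h1 : k - 1 ≤ m) (h2 : m ≤ 3 * (k - 1) / 2) :
    (∃ F : SimpleGraph (Fin k), IsF k m F) ∧
      ∀ F F' : SimpleGraph (Fin k), IsF k m F → IsF k m F' → Nonempty (F ≃g F') := by
  refine ⟨⟨windmillGraph k (m - (k - 1)), ?_⟩, fun F F' hF hF' => ?_⟩
  · have := isF_windmillGraph (k := k) (a := m - (k - 1)) (by omega) (by omega)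
    rwa [Nat.add_sub_cancel' h1] at this
  · obtain ⟨c, hc, hdeg⟩ := hF.exists_isWindmill
    obtain ⟨c', hc', hdeg'⟩ := hF'.exists_isWindmill
    exact hc.nonempty_iso hc' rfl (hdeg.trans hdeg'.symm) (hF.size_eq.trans hF'.size_eq.symm)

theorem star_isWindmill (r : ℕ) :
    IsWindmill (completeBipartiteGraph (Fin 1) (Fin r)) (Sum.inl 0) := by
  constructor
  · rintro (a | a) (b | b) hab ha
    · exact absurd (congrArg Sum.inl (Subsingleton.elim a 0)) ha
    · exact absurd (congrArg Sum.inl (Subsingleton.elim a 0)) ha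
    · simp
    · simp at hab
  · rintro (u | u) (w | w) w' hu hw hw' h h'
    · exact absurd (congrArg Sum.inl (Subsingleton.elim u 0)) hu
    · exact absurd (congrArg Sum.inl (Subsingleton.elim u 0)) hu
    · exact absurd (congrArg Sum.inl (Subsingleton.elim w 0)) hw
    · simp at h

theorem star_degree (r : ℕ) :
    ((completeBipartiteGraph (Fin 1) (Fin r)).neighborSet (Sum.inl 0)).ncard = r := by
  have : (completeBipartiteGraph (Fin 1) (Fin r)).neighborSet (Sum.inl 0) = Set.range Sum.inr := by
    ext (x | x) <;> simp
  rw [this, ← Set.image_univ, Set.ncard_image_of_injective _ Sum.inr_injective, Set.ncard_univ,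
    Nat.card_fin]

theorem star_size (r : ℕ) : size (completeBipartiteGraph (Fin 1) (Fin r)) = r := by
  have h1 := (star_isWindmill r).card_bladeSet
  have h2 : bladeSet (completeBipartiteGraph (Fin 1) (Fin r)) (Sum.inl 0) = ∅ := by
    refine Finset.filter_eq_empty_iff.2 ?_
    rintro (x | x) - ⟨hx, (w | w), hw, hxw⟩ <;> simp at hx hw hxw
  rw [star_degree, h2, Finset.card_empty] at h1
  omega

theorem triangle_isWindmill : IsWindmill (⊤ : SimpleGraph (Fin 3)) 0 := by
  constructor
  · intro a b _ ha
    exact ha.symm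
  · intro u w w' hu hw hw' h h'
    simp only [SimpleGraph.top_adj, ne_eq, Fin.ext_iff, Fin.val_zero] at *
    omega

theorem triangle_degree : ((⊤ : SimpleGraph (Fin 3)).neighborSet 0).ncard = 2 := by
  have : (⊤ : SimpleGraph (Fin 3)).neighborSet 0 = ↑({1, 2} : Finset (Fin 3)) := by
    ext x
    fin_cases x <;> simp
  rw [this, Set.ncard_coe_finset]
  rfl

theorem triangle_size : size (⊤ : SimpleGraph (Fin 3)) = 3 := by
  rw [size, ← SimpleGraph.coe_edgeFinset, Set.ncard_coe_finset,
    SimpleGraph.card_edgeFinset_top_eq_card_choose_two]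
  rfl

end Existence

end OddCycle

theorem theorem1p4 {V : Type*} [Finite V] (G : SimpleGraph V) (n m : ℕ)
    (hn : Nat.card V = n) (hsize : OddCycle.size G = m)
    (hG : OddCycle.IsOddCycleGraph G)
    (hm1 : 1 ≤ m) (hm2 : m ≤ 3 * (n - 1) / 2) :
    -- `t(G)` is well defined: the matching polynomial has a largest real root
    IsGreatest {x : ℝ | (OddCycle.matchingPoly G).IsRoot x} (OddCycle.maxMatchingRoot G) ∧
    -- `F(k, m)` exists and is unique up to isomorphism
    (∀ k : ℕ, 1 ≤ k → k - 1 ≤ m → m ≤ 3 * (k - 1) / 2 →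
      (∃ F : SimpleGraph (Fin k), OddCycle.IsF k m F) ∧
      ∀ F F' : SimpleGraph (Fin k), OddCycle.IsF k m F → OddCycle.IsF k m F' →
        Nonempty (F ≃g F')) ∧
    (m = 1 → OddCycle.maxMatchingRoot G = 1) ∧
    (m = 2 →
      OddCycle.maxMatchingRoot G ≤ √2 ∧
      (OddCycle.maxMatchingRoot G = √2 ↔
        Nonempty (G ≃g (completeBipartiteGraph (Fin 1) (Fin 2) ⊕g
          (⊥ : SimpleGraph (Fin (n - 3))))))) ∧
    (m = 3 →
      OddCycle.maxMatchingRoot G ≤ √3 ∧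
      (OddCycle.maxMatchingRoot G = √3 ↔
        Nonempty (G ≃g ((⊤ : SimpleGraph (Fin 3)) ⊕g (⊥ : SimpleGraph (Fin (n - 3))))) ∨
        Nonempty (G ≃g (completeBipartiteGraph (Fin 1) (Fin 3) ⊕g
          (⊥ : SimpleGraph (Fin (n - 4))))))) ∧
    (4 ≤ m → m ≤ n - 2 →
      ∀ F : SimpleGraph (Fin (m + 1)), OddCycle.IsF (m + 1) m F →
        OddCycle.maxMatchingRoot G ≤ OddCycle.maxMatchingRoot F ∧
        (OddCycle.maxMatchingRoot G = OddCycle.maxMatchingRoot F ↔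
          Nonempty (G ≃g (F ⊕g (⊥ : SimpleGraph (Fin (n - m - 1))))))) ∧
    (n - 1 ≤ m → m ≤ 3 * (n - 1) / 2 → 4 ≤ m →
      ∀ F : SimpleGraph (Fin n), OddCycle.IsF n m F →
        OddCycle.maxMatchingRoot G ≤ OddCycle.maxMatchingRoot F ∧
        (OddCycle.maxMatchingRoot G = OddCycle.maxMatchingRoot F ↔
          Nonempty (G ≃g F))) := by

  classical
  cases nonempty_fintype V
  have hcard : Fintype.card V = n := by rw [← hn, Nat.card_eq_fintype_card]
  have hedge : ∃ u v, G.Adj u v := by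
    obtain ⟨e, he⟩ := (Set.ncard_pos (Set.toFinite _)).1
      (show 0 < G.edgeSet.ncard from hm1.trans_eq hsize.symm)
    induction e with
    | _ u v => exact ⟨u, v, he⟩
  obtain ⟨u, v, huv⟩ := hedge
  refine ⟨OddCycle.isGreatest_maxMatchingRoot huv, fun k => OddCycle.isF_existsUnique, ?_, ?_, ?_,
    ?_, ?_⟩
  · rintro rfl
    exact hG.maxMatchingRoot_eq_one hsize
  · rintro rfl
    obtain ⟨h1, h2⟩ := hG.maxMatchingRoot_le_sqrt_two hsize
    refine ⟨h1, h2.trans ?_⟩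
    rw [OddCycle.nonempty_iso_sum_bot_iff (OddCycle.star_isWindmill 2)
      (by rw [hsize, OddCycle.star_size]) (by simp; omega), OddCycle.star_degree]
  · rintro rfl
    obtain ⟨h1, h2⟩ := hG.maxMatchingRoot_le_sqrt_three hsize
    refine ⟨h1, h2.trans ?_⟩
    have htri := OddCycle.nonempty_iso_sum_bot_iff (G := G) (U := Fin (n - 3))
      OddCycle.triangle_isWindmill (by rw [hsize, OddCycle.triangle_size]) (by simp; omega)
    rw [OddCycle.triangle_degree] at htri
    -- For n = 3 the truncated `n - 4` is 0 and the star has too many vertices; so both directions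
    -- below derive `4 ≤ n` first.
    have hstar : ∀ _ : 4 ≤ n, _ := fun h4 => OddCycle.nonempty_iso_sum_bot_iff (G := G)
      (U := Fin (n - 4)) (OddCycle.star_isWindmill 3) (by rw [hsize, OddCycle.star_size])
      (by simp; omega)
    rw [OddCycle.star_degree] at hstar
    rw [htri]
    constructor
    · rintro ⟨c, hc, hdeg | hdeg⟩
      · exact Or.inl ⟨c, hc, hdeg⟩
      · have h4 : 4 ≤ n := by
          have hlt : (G.neighborSet c).ncard < Nat.card V := by
            rw [← Set.ncard_univ]
            refine Set.ncard_lt_ncard (Set.ssubset_univ_iff.2 fun h => ?_) (Set.toFinite _)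
            exact G.loopless.irrefl c (h.symm ▸ Set.mem_univ c : c ∈ G.neighborSet c)
          omega
        exact Or.inr ((hstar h4).2 ⟨c, hc, hdeg⟩)
    · rintro (⟨c, hc, hdeg⟩ | he)
      · exact ⟨c, hc, Or.inl hdeg⟩
      · have h4 : 4 ≤ n := by
          obtain ⟨e⟩ := he
          have := Fintype.card_congr e.toEquiv
          simp at this
          omega
        obtain ⟨c, hc, hdeg⟩ := (hstar h4).1 he
        exact ⟨c, hc, Or.inr hdeg⟩
  · intro h4 hmn F hF
    -- With few edges, connectedness limits the order of a connected set to m + 1; in the last case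
    -- the limit is n itself.
    obtain ⟨h1, h2⟩ := hG.maxMatchingRoot_le_isF hsize (by omega) h4 le_rfl
      (fun B hB => by
        have := hB.card_le_size
        omega) hF
    refine ⟨h1, h2.trans ?_⟩
    obtain ⟨c, hc, hdeg⟩ := hF.exists_isWindmill
    rw [OddCycle.nonempty_iso_sum_bot_iff hc (by rw [hsize, hF.size_eq]) (by simp; omega), hdeg]
  · intro hnm _ h4 F hF
    obtain ⟨h1, h2⟩ := hG.maxMatchingRoot_le_isF hsize (by omega) h4 (by omega)
      (fun B _ => by
        rw [← hcard]
        exact Finset.card_le_univ B) hF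
    refine ⟨h1, h2.trans ?_⟩
    obtain ⟨c, hc, hdeg⟩ := hF.exists_isWindmill
    rw [OddCycle.nonempty_iso_iff hc (by rw [hsize, hF.size_eq]) (by simp; omega), hdeg]
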